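/- Theorem A. Let $X$ be a complex surface, i.e. a (Hausdorff, second countable) complex manifold of complex dimension $2$, with complex structure $J$, and let $g$ be a smooth Hermitian metric on $X$ with fundamental form $\omega(\cdot,\cdot)=g(\cdot,J\cdot)$. Let $\nabla^{LC}$ be the Levi-Civita connection of $g$, and let $\nabla^B$ be its Bismut connection, i.e. the unique affine connection with $\nabla^B g=0$, $\nabla^B J=0$ whose torsion tensor $T^B(x,y,z)=g(T^B(x,y),z)$, where $T^B(x,y)=\nabla^B_xy-\nabla^B_yx-[x,y]$, is totally skew-symmetric. Then the following are equivalent: (1) $g$ is Vaisman, that is, there is a smooth real $1$-form $\theta$ on $X$ with $d\theta=0$, $d\omega=\theta\wedge\omega$ and $\nabla^{LC}\theta=0$ (the case $\theta=0$, in which $g$ is Kähler, is included); (2) $g$ is SKT, that is, the $3$-form $T^B$ is closed, $dT^B=0$; and $\nabla^B$ satisfies the first Bianchi identity $$R^B(x,y)z+R^B(y,z)x+R^B(z,x)y=0$$ for all vector fields $x,y,z$, where $R^B(x,y)z=\nabla^B_x\nabla^B_yz-\nabla^B_y\nabla^B_xz-\nabla^B_{[x,y]}z$. -/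

import Mathlib

open scoped Manifold ContDiff Bundle

noncomputable section

namespace HermitianGeometry

/-- A complex manifold, regarded as a real-analytic (in particular smooth) real manifold. -/
instance isManifold_real {E : Type*} [NormedAddCommGroup E] [NormedSpace ℂ E]
    {X : Type*} [TopologicalSpace X] [ChartedSpace E X] [IsManifold 𝓘(ℂ, E) ω X] :
    IsManifold 𝓘(ℝ, E) ω X := by
  refine isManifold_of_contDiffOn 𝓘(ℝ, E) ω X fun e e' he he' => ?_
  have h := (mem_groupoid_of_pregroupoid.1 ((contDiffGroupoid ω 𝓘(ℂ, E)).compatible he he')).1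
  exact ContDiffOn.restrict_scalars ℝ h

/-- Finite-dimensional complex normed spaces are complete. -/
instance (priority := 50) completeSpace_of_finiteDimensional {E : Type*} [NormedAddCommGroup E]
    [NormedSpace ℂ E] [FiniteDimensional ℂ E] : CompleteSpace E :=
  FiniteDimensional.complete ℂ E

variable {E : Type*} [NormedAddCommGroup E] [NormedSpace ℂ E]
  {X : Type*} [TopologicalSpace X] [ChartedSpace E X]

/-! ### Tensors on a complex manifold -/

/-- The complex structure on the (real) tangent space at `x`. The tangent space at `x` is the model
space `E`, through the preferred holomorphic chart at `x`; all changes of charts have complex linear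
differentials, so this is the usual almost complex structure. -/
def J (x : X) : TangentSpace 𝓘(ℝ, E) x →L[ℝ] TangentSpace 𝓘(ℝ, E) x :=
  (Complex.I • ContinuousLinearMap.id ℝ E : E →L[ℝ] E)

/-- The derivative `V f` of a real function `f` along a vector field `V`. -/
def deriv (V : Π x : X, TangentSpace 𝓘(ℝ, E) x) (f : X → ℝ) (x : X) : ℝ :=
  mvfderiv 𝓘(ℝ, E) f x (V x)

/-- The Lie bracket `[V, W]` of vector fields. -/
def bracket (V W : Π x : X, TangentSpace 𝓘(ℝ, E) x) : Π x : X, TangentSpace 𝓘(ℝ, E) x :=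
  VectorField.mlieBracket 𝓘(ℝ, E) V W

/-- The exterior derivative of a `1`-form, evaluated on vector fields. -/
def d₁ (θ : Π x : X, TangentSpace 𝓘(ℝ, E) x → ℝ)
    (V₀ V₁ : Π x : X, TangentSpace 𝓘(ℝ, E) x) (x : X) : ℝ :=
  deriv V₀ (fun y ↦ θ y (V₁ y)) x - deriv V₁ (fun y ↦ θ y (V₀ y)) x - θ x (bracket V₀ V₁ x)

/-- The exterior derivative of a `2`-form, evaluated on vector fields. -/
def d₂ (α : Π x : X, TangentSpace 𝓘(ℝ, E) x → TangentSpace 𝓘(ℝ, E) x → ℝ)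
    (V₀ V₁ V₂ : Π x : X, TangentSpace 𝓘(ℝ, E) x) (x : X) : ℝ :=
  deriv V₀ (fun y ↦ α y (V₁ y) (V₂ y)) x
    - deriv V₁ (fun y ↦ α y (V₀ y) (V₂ y)) x
    + deriv V₂ (fun y ↦ α y (V₀ y) (V₁ y)) x
    - α x (bracket V₀ V₁ x) (V₂ x)
    + α x (bracket V₀ V₂ x) (V₁ x)
    - α x (bracket V₁ V₂ x) (V₀ x)

/-- The exterior derivative of a `3`-form, evaluated on vector fields. -/
def d₃ (T : Π x : X, TangentSpace 𝓘(ℝ, E) x → TangentSpace 𝓘(ℝ, E) x →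
      TangentSpace 𝓘(ℝ, E) x → ℝ)
    (V₀ V₁ V₂ V₃ : Π x : X, TangentSpace 𝓘(ℝ, E) x) (x : X) : ℝ :=
  deriv V₀ (fun y ↦ T y (V₁ y) (V₂ y) (V₃ y)) x
    - deriv V₁ (fun y ↦ T y (V₀ y) (V₂ y) (V₃ y)) x
    + deriv V₂ (fun y ↦ T y (V₀ y) (V₁ y) (V₃ y)) x
    - deriv V₃ (fun y ↦ T y (V₀ y) (V₁ y) (V₂ y)) x
    - T x (bracket V₀ V₁ x) (V₂ x) (V₃ x)
    + T x (bracket V₀ V₂ x) (V₁ x) (V₃ x)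
    - T x (bracket V₀ V₃ x) (V₁ x) (V₂ x)
    - T x (bracket V₁ V₂ x) (V₀ x) (V₃ x)
    + T x (bracket V₁ V₃ x) (V₀ x) (V₂ x)
    - T x (bracket V₂ V₃ x) (V₀ x) (V₁ x)

/-- The wedge product of a `1`-form and a `2`-form, evaluated on tangent vectors. -/
def wedge₁₂ (θ : Π x : X, TangentSpace 𝓘(ℝ, E) x → ℝ)
    (α : Π x : X, TangentSpace 𝓘(ℝ, E) x → TangentSpace 𝓘(ℝ, E) x → ℝ)
    (x : X) (u v w : TangentSpace 𝓘(ℝ, E) x) : ℝ :=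
  θ x u * α x v w - θ x v * α x u w + θ x w * α x u v

variable [IsManifold 𝓘(ℂ, E) ω X]

/-- A vector field is smooth if it is a `C^∞` section of the real tangent bundle. -/
def IsSmoothVectorField (V : Π x : X, TangentSpace 𝓘(ℝ, E) x) : Prop :=
  ContMDiff 𝓘(ℝ, E) (𝓘(ℝ, E).prod 𝓘(ℝ, E)) ∞
    (fun x ↦ Bundle.TotalSpace.mk' E (E := fun x : X ↦ TangentSpace 𝓘(ℝ, E) x) x (V x))

/-- A real `1`-form is smooth if it is a `C^∞` section of the real cotangent bundle. -/
def IsSmoothOneForm (θ : Π x : X, TangentSpace 𝓘(ℝ, E) x →L[ℝ] ℝ) : Prop :=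
  ContMDiff 𝓘(ℝ, E) (𝓘(ℝ, E).prod 𝓘(ℝ, E →L[ℝ] ℝ)) ∞
    (fun x ↦ Bundle.TotalSpace.mk' (E →L[ℝ] ℝ)
      (E := fun x : X ↦ TangentSpace 𝓘(ℝ, E) x →L[ℝ] Bundle.Trivial X ℝ x) x (θ x))

/-! ### Affine connections -/

variable (E X) in
/-- Affine connections on `X`, that is, covariant derivatives on its real tangent bundle;
`D Y x v` is the derivative at `x` of the vector field `Y` in the direction `v`. -/
abbrev AffineConnection : Type _ :=
  CovariantDerivative 𝓘(ℝ, E) E (fun x : X ↦ TangentSpace 𝓘(ℝ, E) x)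

namespace AffineConnection

/-- The vector field `∇_V W`. -/
def along (D : AffineConnection E X) (V W : Π x : X, TangentSpace 𝓘(ℝ, E) x) :
    Π x : X, TangentSpace 𝓘(ℝ, E) x :=
  fun x ↦ D W x (V x)

/-- The curvature `R(U, V) W = ∇_U ∇_V W - ∇_V ∇_U W - ∇_{[U, V]} W`. -/
def curvature (D : AffineConnection E X) (U V W : Π x : X, TangentSpace 𝓘(ℝ, E) x) :
    Π x : X, TangentSpace 𝓘(ℝ, E) x :=
  D.along U (D.along V W) - D.along V (D.along U W) - D.along (bracket U V) W

/-- The first Bianchi identity: the cyclic sum of `R(U, V) W` vanishes. -/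
def FirstBianchi (D : AffineConnection E X) : Prop :=
  ∀ U V W : Π x : X, TangentSpace 𝓘(ℝ, E) x,
    IsSmoothVectorField U → IsSmoothVectorField V → IsSmoothVectorField W →
      D.curvature U V W + D.curvature V W U + D.curvature W U V = 0

/-- The `1`-form `θ` is parallel: `(∇_V θ)(W) = V (θ(W)) - θ(∇_V W)` vanishes. -/
def IsParallelOneForm (D : AffineConnection E X)
    (θ : Π x : X, TangentSpace 𝓘(ℝ, E) x →L[ℝ] ℝ) : Prop :=
  ∀ V W : Π x : X, TangentSpace 𝓘(ℝ, E) x, IsSmoothVectorField V → IsSmoothVectorField W →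
    ∀ x, deriv V (fun y ↦ θ y (W y)) x - θ x (D.along V W x) = 0

/-- The connection preserves the complex structure: `∇_V (J W) = J (∇_V W)`. -/
def PreservesJ (D : AffineConnection E X) : Prop :=
  ∀ V W : Π x : X, TangentSpace 𝓘(ℝ, E) x, IsSmoothVectorField V → IsSmoothVectorField W →
    ∀ x, D.along V (fun y ↦ J y (W y)) x = J x (D.along V W x)

end AffineConnection

/-! ### Hermitian metrics -/

variable (E X) in
/-- A (smooth) Hermitian metric on the complex manifold `X`: a smooth Riemannian metric for which
the complex structure is orthogonal. -/
structure HermitianMetric extends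
    Bundle.ContMDiffRiemannianMetric 𝓘(ℝ, E) ∞ E (fun x : X ↦ TangentSpace 𝓘(ℝ, E) x) where
  inner_J_J (x : X) (u v : TangentSpace 𝓘(ℝ, E) x) : inner x (J x u) (J x v) = inner x u v

namespace HermitianMetric

/-- The fundamental form `ω(u, v) = g(u, J v)`. -/
def fundamentalForm (g : HermitianMetric E X) (x : X) (u v : TangentSpace 𝓘(ℝ, E) x) : ℝ :=
  g.inner x u (J x v)

variable [FiniteDimensional ℂ E]

/-- The connection `D` is metric: `∇g = 0`. -/
def IsMetricConnection (g : HermitianMetric E X) (D : AffineConnection E X) : Prop :=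
  letI : Bundle.RiemannianBundle (fun x : X ↦ TangentSpace 𝓘(ℝ, E) x) := ⟨g.toRiemannianMetric⟩
  CovariantDerivative.IsMetricCompatible (V := fun x : X ↦ TangentSpace 𝓘(ℝ, E) x) D

/-- The torsion of a connection as a covariant tensor, `T(u, v, w) = g(T(u, v), w)`. -/
def torsionForm (g : HermitianMetric E X) (D : AffineConnection E X)
    (x : X) (u v w : TangentSpace 𝓘(ℝ, E) x) : ℝ :=
  g.inner x (D.torsion x u v) w

/-- `D` is the Levi-Civita connection of `g`: it is metric and torsion-free. -/
structure IsLeviCivita (g : HermitianMetric E X) (D : AffineConnection E X) : Prop where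
  metric : g.IsMetricConnection D
  torsion_eq_zero : D.torsion = 0

/-- `D` is the Bismut connection of `g`: it is Hermitian (`∇g = 0` and `∇J = 0`) and its torsion
tensor is totally skew-symmetric (skew-symmetry in the first two arguments is automatic). -/
structure IsBismut (g : HermitianMetric E X) (D : AffineConnection E X) : Prop where
  metric : g.IsMetricConnection D
  complex : D.PreservesJ
  skew : ∀ (x : X) (u v w : TangentSpace 𝓘(ℝ, E) x),
    g.torsionForm D x u v w = -g.torsionForm D x u w v

/-- `g` is SKT (pluriclosed): the torsion `3`-form of its Bismut connection is closed. -/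
def IsSKT (g : HermitianMetric E X) : Prop :=
  ∃ D : AffineConnection E X, g.IsBismut D ∧
    ∀ V₀ V₁ V₂ V₃ : Π x : X, TangentSpace 𝓘(ℝ, E) x,
      IsSmoothVectorField V₀ → IsSmoothVectorField V₁ →
      IsSmoothVectorField V₂ → IsSmoothVectorField V₃ →
        ∀ x, d₃ (g.torsionForm D) V₀ V₁ V₂ V₃ x = 0

/-- The Bismut connection of `g` satisfies the first Bianchi identity. -/
def BismutFirstBianchi (g : HermitianMetric E X) : Prop :=
  ∃ D : AffineConnection E X, g.IsBismut D ∧ D.FirstBianchi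

/-- `g` is Vaisman: `dω = θ ∧ ω` for some closed `1`-form `θ` which is parallel with respect to the
Levi-Civita connection. -/
def IsVaisman (g : HermitianMetric E X) : Prop :=
  ∃ θ : Π x : X, TangentSpace 𝓘(ℝ, E) x →L[ℝ] ℝ,
    IsSmoothOneForm θ ∧
    (∀ V₀ V₁ : Π x : X, TangentSpace 𝓘(ℝ, E) x,
      IsSmoothVectorField V₀ → IsSmoothVectorField V₁ →
        ∀ x, d₁ (fun y v ↦ θ y v) V₀ V₁ x = 0) ∧
    (∀ V₀ V₁ V₂ : Π x : X, TangentSpace 𝓘(ℝ, E) x,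
      IsSmoothVectorField V₀ → IsSmoothVectorField V₁ → IsSmoothVectorField V₂ →
        ∀ x, d₂ g.fundamentalForm V₀ V₁ V₂ x =
          wedge₁₂ (fun y v ↦ θ y v) g.fundamentalForm x (V₀ x) (V₁ x) (V₂ x)) ∧
    ∃ D : AffineConnection E X, g.IsLeviCivita D ∧ D.IsParallelOneForm θ

end HermitianMetric
end HermitianGeometry
end

/-! On a complex surface, wedging with ω is an isomorphism from 1-forms to 3-forms. The Bismut
torsion is therefore T = -(θ∘J) ∧ ω for a unique 1-form θ (`exists_leeTorsion_eq`), and since the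
connection is Hermitian, dω is the cyclic sum of T(·,·,J·). This gives dω = θ ∧ ω, so θ is the Lee
form.

For a metric connection with skew torsion, the cyclic curvature sum paired with Z equals the cyclic
sum of (∇_U T)(V,W,Z) plus a term Q quadratic in T (`inner_cyclicSum_curvature`). Moreover
dT(U,V,W,Z) is the same cyclic sum minus (∇_Z T)(U,V,W), plus 2Q (`d₃_torsionForm`). The dual vector
ξ of θ annihilates T, so T is a multiple of the volume form of a 3-space and Q = 0
(`sum_inner_torsion_eq_zero`). Hence dT = 0 together with the Bianchi identity is equivalent to ∇ᴮT
= 0.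

Since ∇ᴮg = 0 and ∇ᴮJ = 0, also ∇ᴮω = 0, so ∇ᴮT = 0 exactly when ∇ᴮθ = 0. Finally ∇ᴮ and ∇ᴸᶜ differ
by T/2, and θ(T(u,v)) = T(u,v,ξ) = 0, so ∇ᴮθ = ∇ᴸᶜθ. A form parallel for ∇ᴸᶜ is closed, because ∇ᴸᶜ
has no torsion.

In the direction from Vaisman, the Bismut connection has to be constructed from ∇ᴸᶜ. That it
preserves J rests on the integrability of J (`nijenhuis`), through the formula expressing ∇ᴸᶜJ by dω
(`IsLeviCivita.two_mul_inner_nablaJ`). -/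

noncomputable section

namespace HermitianGeometry

/-! ### Smooth vector fields, brackets and the integrability of J. -/

section Calculus

variable {E : Type*} [NormedAddCommGroup E] [NormedSpace ℂ E]
  {X : Type*} [TopologicalSpace X] [ChartedSpace E X]

lemma J_J (x : X) (v : TangentSpace 𝓘(ℝ, E) x) : J x (J x v) = -v := by
  change (Complex.I • (Complex.I • (show E from v)) : E) = -(show E from v)
  rw [smul_smul, Complex.I_mul_I, neg_one_smul]

variable [IsManifold 𝓘(ℂ, E) ω X]

/-- A real function on `X` is smooth if it is `C^∞`. -/
abbrev IsSmoothFunction (f : X → ℝ) : Prop := ContMDiff 𝓘(ℝ, E) 𝓘(ℝ, ℝ) ∞ f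

namespace IsSmoothVectorField

variable {V W : Π x : X, TangentSpace 𝓘(ℝ, E) x}

lemma mdifferentiableAt (hV : IsSmoothVectorField V) (x : X) :
    MDifferentiableAt 𝓘(ℝ, E) (𝓘(ℝ, E).prod 𝓘(ℝ, E))
      (fun x ↦ Bundle.TotalSpace.mk' E (E := fun x : X ↦ TangentSpace 𝓘(ℝ, E) x) x (V x)) x :=
  ContMDiffAt.mdifferentiableAt (hV x) (by simp)

lemma sub (hV : IsSmoothVectorField V) (hW : IsSmoothVectorField W) :
    IsSmoothVectorField (V - W) := ContMDiff.sub_section hV hW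

lemma neg (hV : IsSmoothVectorField V) : IsSmoothVectorField (-V) := ContMDiff.neg_section hV

lemma smul (hV : IsSmoothVectorField V) {f : X → ℝ} (hf : IsSmoothFunction (E := E) f) :
    IsSmoothVectorField (f • V) := ContMDiff.smul_section hf hV

lemma bracket [FiniteDimensional ℂ E] (hV : IsSmoothVectorField V) (hW : IsSmoothVectorField W) :
    IsSmoothVectorField (bracket V W) := by
  have : IsManifold 𝓘(ℝ, E) (minSmoothness ℝ 2) X := by
    simp only [minSmoothness_of_isRCLikeNormedField]; infer_instance
  have : IsManifold 𝓘(ℝ, E) (((⊤ : ℕ∞) : ℕ∞ω) + 1) X := by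
    exact IsManifold.of_le (n := ω) le_top
  exact ContDiff.mlieBracket_vectorField (m := ⊤) (n := ⊤) hV hW
    (by simp [minSmoothness_of_isRCLikeNormedField])

lemma deriv (hV : IsSmoothVectorField V) {f : X → ℝ} (hf : IsSmoothFunction (E := E) f) :
    IsSmoothFunction (E := E) (deriv V f) := by
  have h := (ContMDiff.contMDiff_tangentMap (m := ∞) hf (by simp)).comp hV
  intro x
  have := (Bundle.contMDiffAt_totalSpace.1 (h x)).2
  refine this.congr_of_eventuallyEq ?_
  filter_upwards with y
  simp [HermitianGeometry.deriv, mvfderiv, tangentMap]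
  rfl

end IsSmoothVectorField

/-- A local extension is cut off by a bump function. Pointwise identities can thus be tested on
globally smooth fields, the only ones over which the definitions quantify. -/
lemma exists_isSmoothVectorField [FiniteDimensional ℂ E] [T2Space X] (x : X)
    (v : TangentSpace 𝓘(ℝ, E) x) :
    ∃ V : Π x : X, TangentSpace 𝓘(ℝ, E) x, IsSmoothVectorField V ∧ V x = v := by
  obtain ⟨s, hs, hsV⟩ := FiberBundle.exists_contMDiffOn_extend (k := ∞) 𝓘(ℝ, E) E
    (V := fun x : X ↦ TangentSpace 𝓘(ℝ, E) x) v
  obtain ⟨f, -, hf⟩ := (SmoothBumpFunction.nhds_basis_tsupport (I := 𝓘(ℝ, E)) x).mem_iff.1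
    (interior_mem_nhds.2 hs)
  refine ⟨(f : X → ℝ) • FiberBundle.extend E v, ?_, ?_⟩
  · exact ContMDiffOn.smul_section_of_tsupport (f.contMDiff.contMDiffOn) isOpen_interior hf
      (hsV.mono interior_subset)
  · simp

lemma jacobi [FiniteDimensional ℂ E] {U V W : Π x : X, TangentSpace 𝓘(ℝ, E) x}
    (hU : IsSmoothVectorField U) (hV : IsSmoothVectorField V) (hW : IsSmoothVectorField W) (x : X) :
    bracket U (bracket V W) x = bracket (bracket U V) W x + bracket V (bracket U W) x := by
  have : IsManifold 𝓘(ℝ, E) (minSmoothness ℝ 3) X := by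
    simp only [minSmoothness_of_isRCLikeNormedField]
    exact IsManifold.of_le (n := ω) le_top
  have hle : minSmoothness ℝ 2 ≤ ∞ := by
    simp only [minSmoothness_of_isRCLikeNormedField]
    exact WithTop.coe_le_coe.2 (le_top : (2 : ℕ∞) ≤ ⊤)
  exact congrFun (VectorField.leibniz_identity_mlieBracket (ContMDiff.of_le hU hle)
    (ContMDiff.of_le hV hle) (ContMDiff.of_le hW hle)) x

omit [IsManifold 𝓘(ℂ, E) ω X] in
lemma bracket_swap (V W : Π x : X, TangentSpace 𝓘(ℝ, E) x) (x : X) :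
    bracket V W x = -bracket W V x := VectorField.mlieBracket_swap_apply

omit [IsManifold 𝓘(ℂ, E) ω X] in
lemma HasMFDerivAt.restrictScalars_real {E' : Type*} [NormedAddCommGroup E'] [NormedSpace ℂ E']
    {Y : Type*} [TopologicalSpace Y] [ChartedSpace E' Y] {f : X → Y} {x : X}
    {f' : TangentSpace 𝓘(ℂ, E) x →L[ℂ] TangentSpace 𝓘(ℂ, E') (f x)}
    (h : HasMFDerivAt 𝓘(ℂ, E) 𝓘(ℂ, E') f x f') :
    HasMFDerivAt 𝓘(ℝ, E) 𝓘(ℝ, E') f x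
      ((f' : E →L[ℂ] E').restrictScalars ℝ : E →L[ℝ] E') :=
  ⟨h.1, HasFDerivWithinAt.restrictScalars ℝ h.2⟩

omit [IsManifold 𝓘(ℂ, E) ω X] in
/-- The differential of a holomorphic map commutes with the complex structures. -/
lemma mfderiv_J {E' : Type*} [NormedAddCommGroup E'] [NormedSpace ℂ E']
    {Y : Type*} [TopologicalSpace Y] [ChartedSpace E' Y] {f : X → Y} {x : X}
    (h : MDifferentiableAt 𝓘(ℂ, E) 𝓘(ℂ, E') f x) (v : TangentSpace 𝓘(ℝ, E) x) :
    mfderiv 𝓘(ℝ, E) 𝓘(ℝ, E') f x (J x v) = J (f x) (mfderiv 𝓘(ℝ, E) 𝓘(ℝ, E') f x v) := by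
  rw [(HasMFDerivAt.restrictScalars_real h.hasMFDerivAt).mfderiv]
  exact (show E →L[ℂ] E' from mfderiv 𝓘(ℂ, E) 𝓘(ℂ, E') f x).map_smul Complex.I (show E from v)

/-- The tangent trivialization at `x` is the differential of a holomorphic chart, so it turns J into
the constant operator of multiplication by I. -/
lemma IsSmoothVectorField.J {V : Π x : X, TangentSpace 𝓘(ℝ, E) x} (hV : IsSmoothVectorField V) :
    IsSmoothVectorField (fun x ↦ J x (V x)) := by
  have : IsManifold 𝓘(ℂ, E) 1 X := IsManifold.of_le (n := ω) le_top
  intro x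
  have h := (Bundle.contMDiffAt_section x).1 (hV x)
  rw [Bundle.contMDiffAt_section]
  refine ((Complex.I • ContinuousLinearMap.id ℝ E : E →L[ℝ] E).contMDiff.contMDiffAt.comp x
    h).congr_of_eventuallyEq ?_
  filter_upwards [(chartAt E x).open_source.mem_nhds (mem_chart_source E x)] with y hy
  have key (v : TangentSpace 𝓘(ℝ, E) y) :
      (trivializationAt E (fun x : X ↦ TangentSpace 𝓘(ℝ, E) x) x ⟨y, v⟩).2
        = mfderiv 𝓘(ℝ, E) 𝓘(ℝ, E) (extChartAt 𝓘(ℝ, E) x) y v := by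
    have h1 := congrArg (fun A : E →L[ℝ] E ↦ A v)
      (TangentBundle.continuousLinearMapAt_trivializationAt (I := 𝓘(ℝ, E)) hy)
    refine Eq.trans ?_ h1
    change _ = Bundle.Trivialization.continuousLinearMapAt ℝ
      (trivializationAt E (TangentSpace 𝓘(ℝ, E)) x) y v
    rw [Bundle.Trivialization.continuousLinearMapAt_apply,
      Bundle.Trivialization.coe_linearMapAt_of_mem]
    simpa using hy
  simp only [Function.comp, key]
  exact mfderiv_J (mdifferentiableAt_extChartAt (I := 𝓘(ℂ, E)) hy) (V y)

omit [IsManifold 𝓘(ℂ, E) ω X] in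
-- The flat case of the vanishing Nijenhuis tensor: multiplication by I is constant, hence commutes
-- with differentiation of the fields.
lemma lieBracket_I_smul {V W : E → E} {y : E} (hV : DifferentiableAt ℝ V y)
    (hW : DifferentiableAt ℝ W y) :
    VectorField.lieBracket ℝ (fun z ↦ Complex.I • V z) (fun z ↦ Complex.I • W z) y =
      Complex.I • VectorField.lieBracket ℝ (fun z ↦ Complex.I • V z) W y
        + Complex.I • VectorField.lieBracket ℝ V (fun z ↦ Complex.I • W z) y
        + VectorField.lieBracket ℝ V W y := by
  simp only [VectorField.lieBracket, fderiv_fun_const_smul hV, fderiv_fun_const_smul hW,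
    _root_.smul_apply, smul_sub, smul_smul, Complex.I_mul_I, neg_one_smul]
  abel

omit [IsManifold 𝓘(ℂ, E) ω X] in
lemma inverse_I_smul {L : E →L[ℝ] E} (hL : L.IsInvertible)
    (h : ∀ v, L (Complex.I • v) = Complex.I • L v) (v : E) :
    L.inverse (Complex.I • v) = Complex.I • L.inverse v := by
  obtain ⟨A, rfl⟩ := hL
  have h' := h (A.symm v)
  simp only [ContinuousLinearEquiv.coe_coe, ContinuousLinearEquiv.apply_symm_apply] at h'
  simp [ContinuousLinearMap.inverse_equiv, ← h']

/-- In a holomorphic chart, the complex structure is multiplication by `I`. -/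
lemma mpullbackWithin_J [FiniteDimensional ℂ E] (V : Π x : X, TangentSpace 𝓘(ℝ, E) x) (x : X)
    {y : E} (hy : y ∈ (extChartAt 𝓘(ℝ, E) x).target) :
    VectorField.mpullbackWithin 𝓘(ℝ, E) 𝓘(ℝ, E) (extChartAt 𝓘(ℝ, E) x).symm (fun z ↦ J z (V z))
        (Set.range 𝓘(ℝ, E)) y =
      (Complex.I • (show E from VectorField.mpullbackWithin 𝓘(ℝ, E) 𝓘(ℝ, E)
        (extChartAt 𝓘(ℝ, E) x).symm V (Set.range 𝓘(ℝ, E)) y) : E) := by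
  have : IsManifold 𝓘(ℂ, E) 1 X := IsManifold.of_le (n := ω) le_top
  have hd : MDifferentiableAt 𝓘(ℂ, E) 𝓘(ℂ, E) (extChartAt 𝓘(ℂ, E) x).symm y :=
    (mdifferentiableOn_extChartAt_symm (I := 𝓘(ℂ, E)) (x := x)).mdifferentiableAt
      ((isOpen_extChartAt_target x).mem_nhds hy)
  have hr : Set.range 𝓘(ℝ, E) = Set.univ := by simp
  have hinv := isInvertible_mfderivWithin_extChartAt_symm (I := 𝓘(ℝ, E)) hy
  rw [VectorField.mpullbackWithin_apply, VectorField.mpullbackWithin_apply, hr]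
  rw [hr] at hinv
  rw [mfderivWithin_univ] at hinv ⊢
  exact inverse_I_smul (E := E) (L := (mfderiv 𝓘(ℝ, E) 𝓘(ℝ, E) (extChartAt 𝓘(ℝ, E) x).symm y :))
    hinv (fun v ↦ mfderiv_J hd v) _

/-- The complex structure of a complex manifold is integrable: its Nijenhuis tensor vanishes. -/
lemma nijenhuis [FiniteDimensional ℂ E] {V W : Π x : X, TangentSpace 𝓘(ℝ, E) x}
    (hV : IsSmoothVectorField V) (hW : IsSmoothVectorField W) (x : X) :
    bracket (fun y ↦ J y (V y)) (fun y ↦ J y (W y)) x =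
      J x (bracket (fun y ↦ J y (V y)) W x) + J x (bracket V (fun y ↦ J y (W y)) x)
        + bracket V W x := by
  have : IsManifold 𝓘(ℂ, E) 1 X := IsManifold.of_le (n := ω) le_top
  let P (V : Π x : X, TangentSpace 𝓘(ℝ, E) x) : E → E :=
    VectorField.mpullbackWithin 𝓘(ℝ, E) 𝓘(ℝ, E) (extChartAt 𝓘(ℝ, E) x).symm V
      (Set.range 𝓘(ℝ, E))
  let y : E := extChartAt 𝓘(ℝ, E) x x
  have hs : (extChartAt 𝓘(ℝ, E) x).symm ⁻¹' Set.univ ∩ Set.range 𝓘(ℝ, E) = Set.univ := by simp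
  have hP {V : Π x : X, TangentSpace 𝓘(ℝ, E) x} (hV : IsSmoothVectorField V) :
      DifferentiableAt ℝ (P V) y := by
    have := MDifferentiableWithinAt.differentiableWithinAt_mpullbackWithin_vectorField
      (hV.mdifferentiableAt x).mdifferentiableWithinAt (s := Set.univ)
    rw [hs] at this
    exact differentiableWithinAt_univ.1 (show DifferentiableWithinAt ℝ (P V) Set.univ y from this)
  -- Equality near the point is enough, since the bracket depends only on germs.
  have hPJ (V : Π x : X, TangentSpace 𝓘(ℝ, E) x) :
      P (fun y ↦ J y (V y)) =ᶠ[nhds y] fun z ↦ Complex.I • P V z := by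
    filter_upwards [extChartAt_target_mem_nhds (I := 𝓘(ℝ, E)) x] with y hy
    exact mpullbackWithin_J V x hy
  let L : E →L[ℝ] E := mfderiv 𝓘(ℝ, E) 𝓘(ℝ, E) (extChartAt 𝓘(ℝ, E) x) x
  have hL : L.IsInvertible :=
    isInvertible_mfderiv_extChartAt (I := 𝓘(ℝ, E)) (x := x) (mem_extChartAt_source x)
  have hLJ (v : E) : L (Complex.I • v) = Complex.I • L v :=
    mfderiv_J (x := x) (f := extChartAt 𝓘(ℝ, E) x)
      (mdifferentiableAt_extChartAt (I := 𝓘(ℂ, E)) (mem_chart_source E x)) v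
  have hJ := inverse_I_smul hL hLJ
  have hb (V W : Π x : X, TangentSpace 𝓘(ℝ, E) x) :
      bracket V W x = L.inverse (VectorField.lieBracket ℝ (P V) (P W) y) := by
    rw [← VectorField.lieBracketWithin_univ, ← hs]
    rfl
  have hJb (V W : Π x : X, TangentSpace 𝓘(ℝ, E) x) :
      J x (bracket V W x) = Complex.I • L.inverse (VectorField.lieBracket ℝ (P V) (P W) y) :=
    congrArg (J x) (hb V W)
  have key : L.inverse (VectorField.lieBracket ℝ (P fun y ↦ J y (V y)) (P fun y ↦ J y (W y)) y) =
      Complex.I • L.inverse (VectorField.lieBracket ℝ (P fun y ↦ J y (V y)) (P W) y)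
        + Complex.I • L.inverse (VectorField.lieBracket ℝ (P V) (P fun y ↦ J y (W y)) y)
        + L.inverse (VectorField.lieBracket ℝ (P V) (P W) y) := by
    rw [(hPJ V).lieBracket_vectorField_eq (hPJ W),
      (hPJ V).lieBracket_vectorField_eq Filter.EventuallyEq.rfl,
      Filter.EventuallyEq.rfl.lieBracket_vectorField_eq (hPJ W),
      lieBracket_I_smul (hP hV) (hP hW), map_add, map_add, hJ, hJ]
  rw [hb, hJb, hJb, hb]
  exact key

end Calculus

/-! ### Vector fields as derivations of smooth functions. -/

section Derivations

variable {E : Type*} [NormedAddCommGroup E] [NormedSpace ℂ E]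
  {X : Type*} [TopologicalSpace X] [ChartedSpace E X]
  {V : Π x : X, TangentSpace 𝓘(ℝ, E) x} {f h : X → ℝ}

lemma IsSmoothFunction.mdifferentiableAt (hf : IsSmoothFunction (E := E) f) (x : X) :
    MDifferentiableAt 𝓘(ℝ, E) 𝓘(ℝ, ℝ) f x :=
  ContMDiffAt.mdifferentiableAt (hf x) (by simp)

lemma IsSmoothFunction.fun_add (hf : IsSmoothFunction (E := E) f)
    (hh : IsSmoothFunction (E := E) h) :
    IsSmoothFunction (E := E) (fun x ↦ f x + h x) := ContMDiff.add hf hh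

lemma IsSmoothFunction.fun_mul (hf : IsSmoothFunction (E := E) f)
    (hh : IsSmoothFunction (E := E) h) :
    IsSmoothFunction (E := E) (fun x ↦ f x * h x) := ContMDiff.mul hf hh

lemma deriv_add (hf : IsSmoothFunction (E := E) f) (hh : IsSmoothFunction (E := E) h) (x : X) :
    deriv V (fun y ↦ f y + h y) x = deriv V f x + deriv V h x := by
  simp [deriv, mvfderiv_fun_add (hf.mdifferentiableAt x) (hh.mdifferentiableAt x)]

lemma deriv_mul (hf : IsSmoothFunction (E := E) f) (hh : IsSmoothFunction (E := E) h) (x : X) :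
    deriv V (fun y ↦ f y * h y) x = deriv V f x * h x + f x * deriv V h x := by
  simp [deriv, mvfderiv_fun_mul (hf.mdifferentiableAt x) (hh.mdifferentiableAt x)]
  ring

lemma deriv_neg (x : X) : deriv V (fun y ↦ -f y) x = -deriv V f x := by
  simp [deriv, mvfderiv_fun_neg]

end Derivations

/-! ### Metric connections with torsion. -/

section Connections

variable {E : Type*} [NormedAddCommGroup E] [NormedSpace ℂ E]
  {X : Type*} [TopologicalSpace X] [ChartedSpace E X] [IsManifold 𝓘(ℂ, E) ω X]
  {U V W : Π x : X, TangentSpace 𝓘(ℝ, E) x}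

namespace AffineConnection

lemma along_add (D : AffineConnection E X) (hV : IsSmoothVectorField V)
    (hW : IsSmoothVectorField W) (x : X) :
    D.along U (V + W) x = D.along U V x + D.along U W x := by
  simp [along, D.isCovariantDerivativeOnUniv.add (hV.mdifferentiableAt x) (hW.mdifferentiableAt x)]

lemma along_neg (D : AffineConnection E X) (hV : IsSmoothVectorField V) (x : X) :
    D.along U (-V) x = -D.along U V x := by
  have h := D.isCovariantDerivativeOnUniv.smul_const (-1) (hV.mdifferentiableAt x)
  rw [neg_one_smul, neg_one_smul] at h
  simp [along, h]

lemma along_sub (D : AffineConnection E X) (hV : IsSmoothVectorField V)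
    (hW : IsSmoothVectorField W) (x : X) :
    D.along U (V - W) x = D.along U V x - D.along U W x := by
  rw [sub_eq_add_neg, along_add D hV hW.neg, along_neg D hW, sub_eq_add_neg]

/-- Used to eliminate every bracket from exterior derivatives and curvature sums, at the price of
torsion terms. -/
lemma bracket_eq [FiniteDimensional ℂ E] (D : AffineConnection E X) (hV : IsSmoothVectorField V)
    (hW : IsSmoothVectorField W) (x : X) :
    bracket V W x = D.along V W x - D.along W V x - D.torsion x (V x) (W x) := by
  rw [D.torsion_apply (hV.mdifferentiableAt x) (hW.mdifferentiableAt x)]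
  simp [along, bracket]

end AffineConnection

namespace HermitianMetric

section Pointwise

variable (g : HermitianMetric E X) (x : X) (u v : TangentSpace 𝓘(ℝ, E) x)

lemma inner_comm : g.inner x u v = g.inner x v u := g.symm x u v

lemma inner_J_right : g.inner x u (J x v) = -g.inner x (J x u) v := by
  rw [← g.inner_J_J x u, J_J, map_neg]

@[simp] lemma inner_self_J : g.inner x u (J x u) = 0 := by
  have := g.inner_J_right x u u
  rw [g.inner_comm x (J x u)] at this
  linarith

variable {u v} in
lemma eq_of_inner_eq (h : ∀ w, g.inner x u w = g.inner x v w) : u = v := by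
  by_contra huv
  have := g.pos x (u - v) (sub_ne_zero.2 huv)
  simp [h] at this

end Pointwise

variable {g : HermitianMetric E X}

lemma isSmoothFunction_inner (g : HermitianMetric E X) (hV : IsSmoothVectorField V)
    (hW : IsSmoothVectorField W) :
    IsSmoothFunction (E := E) (fun x ↦ g.inner x (V x) (W x)) := by
  let _ : Bundle.RiemannianBundle (fun x : X ↦ TangentSpace 𝓘(ℝ, E) x) := ⟨g.toRiemannianMetric⟩
  exact ContMDiff.inner_bundle (E := fun x : X ↦ TangentSpace 𝓘(ℝ, E) x) hV hW

variable [FiniteDimensional ℂ E] {D : AffineConnection E X}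

lemma IsMetricConnection.deriv_inner (hD : g.IsMetricConnection D)
    (U : Π x : X, TangentSpace 𝓘(ℝ, E) x) (hV : IsSmoothVectorField V)
    (hW : IsSmoothVectorField W) (x : X) :
    deriv U (fun y ↦ g.inner y (V y) (W y)) x =
      g.inner x (D.along U V x) (W x) + g.inner x (V x) (D.along U W x) := by
  let _ : Bundle.RiemannianBundle (fun x : X ↦ TangentSpace 𝓘(ℝ, E) x) := ⟨g.toRiemannianMetric⟩
  exact CovariantDerivative.IsMetricCompatible.mvfderiv_inner_eq
    (V := fun x : X ↦ TangentSpace 𝓘(ℝ, E) x) hD U (hV.mdifferentiableAt x) (hW.mdifferentiableAt x)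

/-- In `A x u v` the first argument is the value of the differentiated field and the second is the
direction; `hA` says that each `A x · v` is skew-adjoint. -/
lemma IsMetricConnection.addOneForm (hD : g.IsMetricConnection D)
    (A : Π x : X, TangentSpace 𝓘(ℝ, E) x →L[ℝ]
      TangentSpace 𝓘(ℝ, E) x →L[ℝ] TangentSpace 𝓘(ℝ, E) x)
    (hA : ∀ x u v w, g.inner x (A x u v) w + g.inner x u (A x w v) = 0) :
    g.IsMetricConnection (D.addOneForm A) := by
  let _ : Bundle.RiemannianBundle (fun x : X ↦ TangentSpace 𝓘(ℝ, E) x) := ⟨g.toRiemannianMetric⟩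
  refine (CovariantDerivative.isMetricCompatible_iff
    (V := fun x : X ↦ TangentSpace 𝓘(ℝ, E) x) _).2 fun {x U V W} _ hV hW ↦ ?_
  have h := CovariantDerivative.IsMetricCompatible.mvfderiv_inner_eq
    (V := fun x : X ↦ TangentSpace 𝓘(ℝ, E) x) hD U hV hW
  refine h.trans ?_
  change g.inner x (D V x (U x)) (W x) + g.inner x (V x) (D W x (U x)) =
    g.inner x (D V x (U x) + A x (V x) (U x)) (W x) +
      g.inner x (V x) (D W x (U x) + A x (W x) (U x))
  have := hA x (V x) (U x) (W x)
  simp only [map_add, _root_.add_apply]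
  linarith

omit g in
lemma torsion_addOneForm (A : Π x : X, TangentSpace 𝓘(ℝ, E) x →L[ℝ]
      TangentSpace 𝓘(ℝ, E) x →L[ℝ] TangentSpace 𝓘(ℝ, E) x) (x : X)
    (u v : TangentSpace 𝓘(ℝ, E) x) :
    CovariantDerivative.torsion (D.addOneForm A) x u v = D.torsion x u v + A x v u - A x u v := by
  simp only [CovariantDerivative.torsion_apply_eq_extend, FiberBundle.extend_apply_self]
  change D _ x u + A x _ u - (D _ x v + A x _ v) - _ = _
  simp only [FiberBundle.extend_apply_self]
  abel

/-- The Koszul formula for a metric connection. -/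
lemma IsMetricConnection.koszul (hD : g.IsMetricConnection D) (hU : IsSmoothVectorField U)
    (hV : IsSmoothVectorField V) (hW : IsSmoothVectorField W) (x : X) :
    2 * g.inner x (D.along U V x) (W x) =
      deriv U (fun y ↦ g.inner y (V y) (W y)) x + deriv V (fun y ↦ g.inner y (U y) (W y)) x
        - deriv W (fun y ↦ g.inner y (U y) (V y)) x
        + g.inner x (bracket U V x) (W x) - g.inner x (bracket U W x) (V x)
        - g.inner x (bracket V W x) (U x)
        + g.torsionForm D x (U x) (V x) (W x) - g.torsionForm D x (U x) (W x) (V x)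
        - g.torsionForm D x (V x) (W x) (U x) := by
  rw [hD.deriv_inner U hV hW, hD.deriv_inner V hU hW, hD.deriv_inner W hU hV,
    D.bracket_eq hU hV, D.bracket_eq hU hW, D.bracket_eq hV hW]
  simp only [torsionForm, map_sub, _root_.sub_apply]
  rw [g.inner_comm x (U x), g.inner_comm x (U x), g.inner_comm x (V x)]
  ring

end HermitianMetric

end Connections
namespace HermitianMetric

/-! ### Hermitian linear algebra in complex dimension two. -/

section ComplexSurface

variable {E : Type*} [NormedAddCommGroup E] [NormedSpace ℂ E]
  {X : Type*} [TopologicalSpace X] [ChartedSpace E X] [IsManifold 𝓘(ℂ, E) ω X]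
  (g : HermitianMetric E X) {x : X}

/-- An orthogonal pair of vectors over `ℂ`: the vectors `e, J e, f, J f` are pairwise orthogonal. -/
structure IsOrthogonalPair (x : X) (e f : TangentSpace 𝓘(ℝ, E) x) : Prop where
  left_ne_zero : e ≠ 0
  right_ne_zero : f ≠ 0
  inner_eq_zero : g.inner x e f = 0
  inner_J_eq_zero : g.inner x (J x e) f = 0

/-- Orthogonality of e, Je, f, Jf makes e and f independent over ℂ, hence a complex basis; real and
imaginary parts of the coefficients give the four real ones. -/
lemma exists_eq_add_smul (x : X) (hE : Module.finrank ℂ E = 2) {e f : TangentSpace 𝓘(ℝ, E) x}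
    (h : g.IsOrthogonalPair x e f) (y : TangentSpace 𝓘(ℝ, E) x) :
    ∃ a b c d : ℝ, y = a • e + b • J x e + c • f + d • J x f := by
  have key (z : ℂ) (v : TangentSpace 𝓘(ℝ, E) x) :
      (z • (show E from v) : E) = (z.re • v + z.im • J x v : TangentSpace 𝓘(ℝ, E) x) := by
    change z • (show E from v) = z.re • (show E from v) + z.im • (Complex.I • (show E from v))
    conv_lhs => rw [← Complex.re_add_im z]
    rw [add_smul, mul_smul]
    rfl
  have hli : LinearIndependent ℂ ![(show E from e), (show E from f)] := by
    rw [LinearIndependent.pair_iff]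
    intro s t hst
    rw [key, key] at hst
    have hst : s.re • e + s.im • J x e + (t.re • f + t.im • J x f) = 0 := hst
    have h1 := congrArg (g.inner x e) hst
    have h2 := congrArg (g.inner x (J x e)) hst
    have h3 := congrArg (g.inner x f) hst
    have h4 := congrArg (g.inner x (J x f)) hst
    have he := (g.pos x e h.left_ne_zero).ne'
    have hf := (g.pos x f h.right_ne_zero).ne'
    have e1 := h.inner_eq_zero
    have e2 := h.inner_J_eq_zero
    simp only [map_add, map_smul, smul_eq_mul, inner_self_J, g.inner_J_J, g.inner_comm x (J x e) e,
      g.inner_comm x (J x f) f, g.inner_J_right x f e, g.inner_comm x (J x f) e, e1, e2,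
      g.inner_comm x f e,
      g.inner_J_right x e f, map_zero] at h1 h2 h3 h4
    simp only [mul_zero, neg_zero, add_zero, zero_add, mul_eq_zero, he, hf, or_false] at h1 h2 h3 h4
    exact ⟨Complex.ext h1 h2, Complex.ext h3 h4⟩
  have hspan := hli.span_eq_top_of_card_eq_finrank (by simp [hE])
  have hy : (show E from y) ∈ Submodule.span ℂ (Set.range ![(show E from e), (show E from f)]) := by
    rw [hspan]; trivial
  rw [Matrix.range_cons, Matrix.range_cons, Matrix.range_empty, Set.union_empty,
    Set.singleton_union, Submodule.mem_span_pair] at hy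
  obtain ⟨a, b, hab⟩ := hy
  rw [key, key] at hab
  refine ⟨a.re, a.im, b.re, b.im, hab.symm.trans ?_⟩
  exact (add_assoc (a.re • e + a.im • J x e) (b.re • f) (b.im • J x f)).symm

lemma eq_sum_of_isOrthogonalPair (x : X) (hE : Module.finrank ℂ E = 2)
    {e f : TangentSpace 𝓘(ℝ, E) x} (h : g.IsOrthogonalPair x e f) (y : TangentSpace 𝓘(ℝ, E) x) :
    y = (g.inner x y e / g.inner x e e) • e + (g.inner x y (J x e) / g.inner x e e) • J x e
      + (g.inner x y f / g.inner x f f) • f + (g.inner x y (J x f) / g.inner x f f) • J x f := by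
  obtain ⟨a, b, c, d, rfl⟩ := g.exists_eq_add_smul x hE h y
  have he := (g.pos x e h.left_ne_zero).ne'
  have hf := (g.pos x f h.right_ne_zero).ne'
  have e1 := h.inner_eq_zero
  have e2 := h.inner_J_eq_zero
  simp only [map_add, map_smul, _root_.add_apply, _root_.smul_apply, smul_eq_mul, inner_self_J,
    g.inner_J_J, g.inner_comm x (J x e) e, g.inner_comm x (J x f) f, g.inner_J_right x f e,
    g.inner_comm x (J x f) e, e1, e2, g.inner_comm x f e,
    g.inner_J_right x e f]
  simp [he, hf]

/-- Gram–Schmidt over ℂ, with e along v. When v = 0 any unit vector serves as e, with r = 0. -/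
lemma exists_orthonormal_pair (x : X) (hE : Module.finrank ℂ E = 2) (v : TangentSpace 𝓘(ℝ, E) x) :
    ∃ e f : TangentSpace 𝓘(ℝ, E) x, g.IsOrthogonalPair x e f ∧ g.inner x e e = 1 ∧
      g.inner x f f = 1 ∧ ∃ r : ℝ, v = r • e := by
  have normalize (w : TangentSpace 𝓘(ℝ, E) x) (hw : w ≠ 0) :
      ∃ r : ℝ, r ≠ 0 ∧ g.inner x (r⁻¹ • w) (r⁻¹ • w) = 1 := by
    have := g.pos x w hw
    refine ⟨√(g.inner x w w), by positivity, ?_⟩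
    simp only [map_smul, _root_.smul_apply, smul_eq_mul]
    field_simp
    rw [Real.sq_sqrt this.le]
  have : Nontrivial E := Module.nontrivial_of_finrank_pos (R := ℂ) (by omega)
  obtain ⟨w, hw, s, hv⟩ : ∃ w : TangentSpace 𝓘(ℝ, E) x, w ≠ 0 ∧ ∃ s : ℝ, v = s • w := by
    rcases eq_or_ne v 0 with rfl | hv
    · obtain ⟨w, hw⟩ := exists_ne (0 : E)
      exact ⟨w, hw, 0, (zero_smul ℝ (show TangentSpace 𝓘(ℝ, E) x from w)).symm⟩
    · exact ⟨v, hv, 1, by simp⟩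
  obtain ⟨r, hr, he⟩ := normalize w hw
  set e := r⁻¹ • w with he_def
  have hwe : w = r • e := by simp [he_def, hr]
  have he0 : e ≠ 0 := fun h ↦ by simp [h] at he
  obtain ⟨u, hu⟩ : ∃ u : E, u ∉ Submodule.span ℂ {(show E from e)} := by
    by_contra! hall
    have htop : Submodule.span ℂ {(show E from e)} = ⊤ := by
      rw [eq_top_iff]; exact fun z _ ↦ hall z
    have := finrank_span_singleton (K := ℂ) (show (show E from e) ≠ 0 from he0)
    rw [htop, finrank_top] at this
    omega
  let u' : TangentSpace 𝓘(ℝ, E) x := u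
  let f₀ := u' - g.inner x u' e • e - g.inner x u' (J x e) • J x e
  have hf₀ : f₀ ≠ 0 := by
    intro h0
    apply hu
    rw [Submodule.mem_span_singleton]
    refine ⟨⟨g.inner x u' e, g.inner x u' (J x e)⟩, ?_⟩
    have h0' : u' = g.inner x u' e • e + g.inner x u' (J x e) • J x e := by
      rw [← sub_eq_zero, ← h0]; simp only [f₀]; abel
    refine Eq.trans ?_ h0'.symm
    change _ = g.inner x u' e • (show E from e) +
      g.inner x u' (J x e) • (Complex.I • (show E from e))
    rw [Complex.mk_eq_add_mul_I, add_smul, mul_smul]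
    rfl
  obtain ⟨q, hq, hf⟩ := normalize f₀ hf₀
  have hf0 : q⁻¹ • f₀ ≠ 0 := fun h ↦ by simp [h] at hf
  refine ⟨e, q⁻¹ • f₀, ⟨he0, hf0, ?_, ?_⟩, he, hf, s * r, by rw [hv, hwe, smul_smul]⟩
  · simp [f₀, he, g.inner_comm x e u']
  · simp [f₀, he, g.inner_comm x (J x e) u', g.inner_comm x (J x e) e, g.inner_J_J]

/-- The `3`-form `-(θ ∘ J) ∧ ω`. -/
def leeTorsion (g : HermitianMetric E X) (x : X) (θ : TangentSpace 𝓘(ℝ, E) x → ℝ)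
    (u v w : TangentSpace 𝓘(ℝ, E) x) : ℝ :=
  -(θ (J x u) * g.fundamentalForm x v w + θ (J x v) * g.fundamentalForm x w u
    + θ (J x w) * g.fundamentalForm x u v)

/-- On a complex surface, every `3`-form is the product of a `1`-form and the fundamental form. -/
lemma exists_leeTorsion_eq (x : X) (hE : Module.finrank ℂ E = 2)
    (τ : TangentSpace 𝓘(ℝ, E) x →L[ℝ] TangentSpace 𝓘(ℝ, E) x →L[ℝ] TangentSpace 𝓘(ℝ, E) x)
    (h₁ : ∀ u v, τ u v = -τ v u)
    (h₂ : ∀ u v w, g.inner x (τ u v) w = -g.inner x (τ u w) v) :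
    ∃ θ : TangentSpace 𝓘(ℝ, E) x →L[ℝ] ℝ, ∀ u v w,
      g.inner x (τ u v) w = g.leeTorsion x θ u v w := by
  obtain ⟨e, f, h, he, hf, -⟩ := g.exists_orthonormal_pair x hE 0
  -- Up to sign, θ ∘ J is the contraction of τ with ω. For instance, on (f, Jf, Je) only the term
  -- θ(J(Je)) ω(f, Jf) = θ(e) of the cyclic sum survives, so θ(e) = -g(τ(f, Jf), Je).
  refine ⟨-(g.inner x (τ f (J x f) + τ e (J x e))).comp (J x), fun u v w ↦ ?_⟩
  obtain ⟨a₁, a₂, a₃, a₄, rfl⟩ := g.exists_eq_add_smul x hE h u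
  obtain ⟨b₁, b₂, b₃, b₄, rfl⟩ := g.exists_eq_add_smul x hE h v
  obtain ⟨c₁, c₂, c₃, c₄, rfl⟩ := g.exists_eq_add_smul x hE h w
  have e1 := h.inner_eq_zero
  have e2 := h.inner_J_eq_zero
  have s₁ (u v w) : g.inner x (τ u v) w = -g.inner x (τ v u) w := by rw [h₁ u v]; simp
  have z₁ (u w) : g.inner x (τ u u) w = 0 := by linarith [s₁ u u w]
  have z₂ (u w) : g.inner x (τ u w) w = 0 := by linarith [h₂ u w w]
  have z₃ (u w) : g.inner x (τ u w) u = 0 := by rw [s₁, z₂, neg_zero]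
  -- A 3-form on a real 4-space has four components in the basis e, Je, f, Jf; these rules bring
  -- each of them to a standard order of arguments.
  have perms (u v w) := And.intro (s₁ v u w) (And.intro (h₂ u w v)
    (And.intro (show g.inner x (τ v w) u = g.inner x (τ u v) w by rw [h₂, s₁]; simp)
    (And.intro (show g.inner x (τ w u) v = g.inner x (τ u v) w by rw [s₁, h₂]; simp)
      (show g.inner x (τ w v) u = -g.inner x (τ u v) w by rw [s₁, h₂, s₁]; simp))))
  obtain ⟨p1, p2, p3, p4, p5⟩ := perms e (J x e) f
  obtain ⟨q1, q2, q3, q4, q5⟩ := perms e (J x e) (J x f)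
  obtain ⟨r1, r2, r3, r4, r5⟩ := perms e f (J x f)
  obtain ⟨t1, t2, t3, t4, t5⟩ := perms (J x e) f (J x f)
  simp only [leeTorsion, fundamentalForm, map_add, map_smul, map_neg, _root_.add_apply,
    _root_.smul_apply, _root_.neg_apply, ContinuousLinearMap.comp_apply, J_J, smul_eq_mul,
    inner_self_J, g.inner_J_J, g.inner_comm x (J x e) e, g.inner_comm x (J x f) f,
    g.inner_J_right x f e, smul_neg,
    g.inner_comm x (J x f) e, e1, e2, g.inner_comm x f e, g.inner_J_right x e f,
    he, hf, z₁, z₂, z₃]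
  simp only [p1, p2, p3, p4, p5, q1, q2, q3, q4, q5, r1, r2, r3, r4, r5, t1, t2, t3, t4, t5]
  ring

lemma exists_inner_eq (x : X) (hE : Module.finrank ℂ E = 2) (θ : TangentSpace 𝓘(ℝ, E) x →L[ℝ] ℝ) :
    ∃ ξ : TangentSpace 𝓘(ℝ, E) x, ∀ v, θ v = g.inner x ξ v := by
  obtain ⟨e, f, h, he, hf, -⟩ := g.exists_orthonormal_pair x hE 0
  refine ⟨θ e • e + θ (J x e) • J x e + θ f • f + θ (J x f) • J x f, fun v ↦ ?_⟩
  conv_lhs => rw [g.eq_sum_of_isOrthogonalPair x hE h v]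
  simp only [map_add, map_smul, he, hf, smul_eq_mul, div_one, _root_.add_apply, _root_.smul_apply,
    g.inner_comm x _ v]
  ring

omit [IsManifold 𝓘(ℂ, E) ω X] in
lemma exists_bilinear (x : X) (α : TangentSpace 𝓘(ℝ, E) x →L[ℝ] ℝ)
    (A : TangentSpace 𝓘(ℝ, E) x →L[ℝ] TangentSpace 𝓘(ℝ, E) x)
    (B : TangentSpace 𝓘(ℝ, E) x →L[ℝ] TangentSpace 𝓘(ℝ, E) x →L[ℝ] ℝ)
    (c : TangentSpace 𝓘(ℝ, E) x) :
    ∃ τ : TangentSpace 𝓘(ℝ, E) x →L[ℝ] TangentSpace 𝓘(ℝ, E) x →L[ℝ] TangentSpace 𝓘(ℝ, E) x,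
      ∀ u v, τ u v = α u • A v - α v • A u + B u v • c := by
  let α' : E →L[ℝ] ℝ := α
  let A' : E →L[ℝ] E := A
  let B' : E →L[ℝ] E →L[ℝ] ℝ := B
  let c' : E := c
  let τ' : E →L[ℝ] E →L[ℝ] E := α'.smulRight A' - (α'.smulRight A').flip
    + ((ContinuousLinearMap.smulRightL ℝ E E).flip c').comp B'
  have h (u v : E) : τ' u v = α' u • A' v - α' v • A' u + B' u v • c' := by simp [τ']
  exact ⟨τ', h⟩

lemma exists_leeTorsion (x : X) (hE : Module.finrank ℂ E = 2)
    (θ : TangentSpace 𝓘(ℝ, E) x →L[ℝ] ℝ) :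
    ∃ τ : TangentSpace 𝓘(ℝ, E) x →L[ℝ] TangentSpace 𝓘(ℝ, E) x →L[ℝ] TangentSpace 𝓘(ℝ, E) x,
      ∀ u v w, g.inner x (τ u v) w = g.leeTorsion x θ u v w := by
  obtain ⟨ξ, hξ⟩ := g.exists_inner_eq x hE θ
  -- Raising the last index of -(θ∘J) ∧ ω gives θ(Ju) Jv - θ(Jv) Ju + ω(u,v) Jξ, where ω(u,v) =
  -- -g(Ju,v).
  obtain ⟨τ, hτ⟩ := exists_bilinear x (θ.comp (J x)) (J x) (-((g.inner x).comp (J x))) (J x ξ)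
  refine ⟨τ, fun u v w ↦ ?_⟩
  rw [hτ]
  simp only [leeTorsion, fundamentalForm, map_add, map_sub, map_smul, _root_.add_apply,
    _root_.sub_apply, _root_.smul_apply, _root_.neg_apply, ContinuousLinearMap.comp_apply,
    smul_eq_mul, hξ]
  rw [g.inner_comm x w (J x u), g.inner_J_right x v w, g.inner_J_right x ξ w, g.inner_J_right x u v]
  ring

/-- Contracting (θ∘J) ∧ ω with the dual vector ξ leaves, up to sign, (θ∘J) ∧ (θ∘J) = 0, because
θ(Jξ) = 0 and ω(ξ,·) = θ∘J. This is why torsion corrections do not affect whether θ is parallel. -/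
lemma leeTorsion_inner_eq_zero (x : X) (hE : Module.finrank ℂ E = 2)
    {τ : TangentSpace 𝓘(ℝ, E) x →L[ℝ] TangentSpace 𝓘(ℝ, E) x →L[ℝ] TangentSpace 𝓘(ℝ, E) x}
    {θ : TangentSpace 𝓘(ℝ, E) x →L[ℝ] ℝ}
    (h : ∀ u v w, g.inner x (τ u v) w = g.leeTorsion x θ u v w) (u v : TangentSpace 𝓘(ℝ, E) x) :
    θ (τ u v) = 0 := by
  obtain ⟨ξ, hξ⟩ := g.exists_inner_eq x hE θ
  rw [hξ, g.inner_comm, h, leeTorsion]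
  simp only [hξ, fundamentalForm, inner_self_J]
  rw [g.inner_J_right x v ξ, g.inner_comm x (J x v)]
  ring

/-- The quadratic torsion term in the first Bianchi identity vanishes on complex surfaces. -/
lemma sum_inner_torsion_eq_zero (x : X) (hE : Module.finrank ℂ E = 2)
    {τ : TangentSpace 𝓘(ℝ, E) x →L[ℝ] TangentSpace 𝓘(ℝ, E) x →L[ℝ] TangentSpace 𝓘(ℝ, E) x}
    {θ : TangentSpace 𝓘(ℝ, E) x →L[ℝ] ℝ}
    (h : ∀ u v w, g.inner x (τ u v) w = g.leeTorsion x θ u v w)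
    (u v w z : TangentSpace 𝓘(ℝ, E) x) :
    g.inner x (τ u v) (τ w z) + g.inner x (τ v w) (τ u z) + g.inner x (τ w u) (τ v z) = 0 := by
  obtain ⟨ξ, hξ⟩ := g.exists_inner_eq x hE θ
  -- If ξ ≠ 0, then τ is a multiple of the cross product on the 3-space orthogonal to ξ, and the
  -- claim is the cyclic Binet–Cauchy identity; if ξ = 0 then τ = 0. The check is done in
  -- coordinates adapted to ξ = r e.
  obtain ⟨e, f, hef, he, hf, r, rfl⟩ := g.exists_orthonormal_pair x hE ξ
  have hτ (u v) : τ u v = θ (J x u) • J x v - θ (J x v) • J x u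
      + g.fundamentalForm x u v • J x (r • e) := by
    refine g.eq_of_inner_eq x fun w ↦ ?_
    rw [h]
    simp only [leeTorsion, fundamentalForm, map_add, map_sub, map_smul, _root_.add_apply,
      _root_.sub_apply, _root_.smul_apply, smul_eq_mul, hξ]
    rw [g.inner_comm x w (J x u), g.inner_J_right x v w, g.inner_J_right x e w]
    ring
  have e1 := hef.inner_eq_zero
  have e2 := hef.inner_J_eq_zero
  simp only [hτ]
  obtain ⟨a₁, a₂, a₃, a₄, rfl⟩ := g.exists_eq_add_smul x hE hef u
  obtain ⟨b₁, b₂, b₃, b₄, rfl⟩ := g.exists_eq_add_smul x hE hef v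
  obtain ⟨c₁, c₂, c₃, c₄, rfl⟩ := g.exists_eq_add_smul x hE hef w
  obtain ⟨d₁, d₂, d₃, d₄, rfl⟩ := g.exists_eq_add_smul x hE hef z
  simp only [fundamentalForm, map_add, map_sub, map_smul, map_neg, _root_.add_apply, hξ,
    _root_.smul_apply, _root_.neg_apply, _root_.sub_apply, J_J, smul_eq_mul,
    inner_self_J, g.inner_J_J, g.inner_comm x (J x e) e, g.inner_comm x (J x f) f,
    g.inner_J_right x f e, smul_neg,
    g.inner_comm x (J x f) e, e1, e2, g.inner_comm x f e, g.inner_J_right x e f,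
    he, hf]
  ring

end ComplexSurface

end HermitianMetric

variable {E : Type*} [NormedAddCommGroup E] [NormedSpace ℂ E]
  {X : Type*} [TopologicalSpace X] [ChartedSpace E X] [IsManifold 𝓘(ℂ, E) ω X]
  {U V W Z : Π x : X, TangentSpace 𝓘(ℝ, E) x}

namespace HermitianMetric

variable {g : HermitianMetric E X}

/-! ### Local orthogonal frames and smoothness criteria. -/

section Frames

variable [FiniteDimensional ℂ E] [T2Space X]

/-- Gram–Schmidt without division: W₀ is scaled by g(V,V), so the result is smooth, and orthogonal
to V and JV, even where V vanishes. -/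
lemma exists_smooth_orthogonal (g : HermitianMetric E X) (hE : Module.finrank ℂ E = 2)
    (hV : IsSmoothVectorField V) {x : X} (hx : V x ≠ 0) :
    ∃ W, IsSmoothVectorField W ∧ (∀ y, g.inner y (V y) (W y) = 0 ∧ g.inner y (J y (V y)) (W y) = 0)
      ∧ g.IsOrthogonalPair x (V x) (W x) := by
  obtain ⟨e, f, h, he, hf, r, hr⟩ := g.exists_orthonormal_pair x hE (V x)
  have hr0 : r ≠ 0 := fun h0 ↦ hx (by rw [hr, h0, zero_smul])
  obtain ⟨W₀, hW₀, hW₀x⟩ := exists_isSmoothVectorField x f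
  have hW : ∀ y, g.inner y (V y) (g.inner y (V y) (V y) • W₀ y - g.inner y (W₀ y) (V y) • V y
      - g.inner y (W₀ y) (J y (V y)) • J y (V y)) = 0 ∧
      g.inner y (J y (V y)) (g.inner y (V y) (V y) • W₀ y - g.inner y (W₀ y) (V y) • V y
      - g.inner y (W₀ y) (J y (V y)) • J y (V y)) = 0 := by
    intro y
    simp only [map_sub, map_smul, smul_eq_mul, inner_self_J, g.inner_J_J,
      g.inner_comm y (J y (V y)) (V y), g.inner_comm y (W₀ y)]
    constructor <;> ring
  refine ⟨fun y ↦ g.inner y (V y) (V y) • W₀ y - g.inner y (W₀ y) (V y) • V y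
      - g.inner y (W₀ y) (J y (V y)) • J y (V y), ?_, hW, hx, ?_, (hW x).1, (hW x).2⟩
  · exact ((hW₀.smul (g.isSmoothFunction_inner hV hV)).sub
      (hV.smul (g.isSmoothFunction_inner hW₀ hV))).sub
      (hV.J.smul (g.isSmoothFunction_inner hW₀ hV.J))
  · have e1 := h.inner_eq_zero
    have e2 := h.inner_J_eq_zero
    beta_reduce
    rw [hW₀x, hr]
    simp only [map_smul, _root_.smul_apply, g.inner_comm x f, e1, e2, he]
    simpa using ⟨hr0, h.right_ne_zero⟩

omit [FiniteDimensional ℂ E] [T2Space X] in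
lemma eventually_ne_zero (g : HermitianMetric E X) (hV : IsSmoothVectorField V) {x : X}
    (hx : V x ≠ 0) : ∀ᶠ y in nhds x, V y ≠ 0 := by
  have h := (g.isSmoothFunction_inner hV hV).continuous.continuousAt (x := x)
  filter_upwards [h.eventually_ne (g.pos x _ hx).ne'] with y hy h0
  simp [h0] at hy

lemma exists_frame (g : HermitianMetric E X) (hE : Module.finrank ℂ E = 2) (x : X) :
    ∃ V W, IsSmoothVectorField V ∧ IsSmoothVectorField W ∧
      ∀ᶠ y in nhds x, g.IsOrthogonalPair y (V y) (W y) := by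
  obtain ⟨e, f, h, -⟩ := g.exists_orthonormal_pair x hE 0
  obtain ⟨V, hV, rfl⟩ := exists_isSmoothVectorField x e
  obtain ⟨W, hW, hperp, hx⟩ := g.exists_smooth_orthogonal hE hV h.left_ne_zero
  refine ⟨V, W, hV, hW, ?_⟩
  filter_upwards [g.eventually_ne_zero hV hx.left_ne_zero,
    g.eventually_ne_zero hW hx.right_ne_zero] with y hy hy'
  exact ⟨hy, hy', (hperp y).1, (hperp y).2⟩

omit [FiniteDimensional ℂ E] [T2Space X] in
lemma contMDiffAt_inner_div (g : HermitianMetric E X) {x : X} {f : X → ℝ}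
    (hf : ContMDiffAt 𝓘(ℝ, E) 𝓘(ℝ, ℝ) ∞ f x)
    (hV : IsSmoothVectorField V) (hx : V x ≠ 0) :
    ContMDiffAt 𝓘(ℝ, E) 𝓘(ℝ, ℝ) ∞ (fun y ↦ f y / g.inner y (V y) (V y)) x :=
  hf.div₀ (g.isSmoothFunction_inner hV hV x) (g.pos x _ hx).ne'

/-- In a local orthogonal frame the coefficients of V are quotients of smooth functions by squared
norms of nonvanishing fields. -/
lemma isSmoothVectorField_of_inner (g : HermitianMetric E X) (hE : Module.finrank ℂ E = 2)
    (h : ∀ W, IsSmoothVectorField W → IsSmoothFunction (E := E) fun x ↦ g.inner x (V x) (W x)) :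
    IsSmoothVectorField V := by
  intro x
  obtain ⟨A, B, hA, hB, hAB⟩ := g.exists_frame hE x
  have hx := hAB.self_of_nhds
  have s₁ := ContMDiffAt.smul_section (g.contMDiffAt_inner_div (h A hA x) hA hx.left_ne_zero) (hA x)
  have s₂ := ContMDiffAt.smul_section (g.contMDiffAt_inner_div (h _ hA.J x) hA hx.left_ne_zero)
    (hA.J x)
  have s₃ := ContMDiffAt.smul_section (g.contMDiffAt_inner_div (h B hB x) hB hx.right_ne_zero)
    (hB x)
  have s₄ := ContMDiffAt.smul_section (g.contMDiffAt_inner_div (h _ hB.J x) hB hx.right_ne_zero)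
    (hB.J x)
  refine (((s₁.add_section s₂).add_section s₃).add_section s₄).congr_of_eventuallyEq ?_
  filter_upwards [hAB] with y hy
  exact congrArg (Bundle.TotalSpace.mk' E y) (g.eq_sum_of_isOrthogonalPair y hE hy (V y))

/-- A `1`-form is smooth as soon as it takes smooth values on suitable local frames. -/
lemma isSmoothOneForm_of_apply (g : HermitianMetric E X) (hE : Module.finrank ℂ E = 2)
    {θ : Π x : X, TangentSpace 𝓘(ℝ, E) x →L[ℝ] ℝ}
    (h : ∀ W, IsSmoothVectorField W → ∀ x, W x ≠ 0 →
      ContMDiffAt 𝓘(ℝ, E) 𝓘(ℝ, ℝ) ∞ (fun x ↦ θ x (W x)) x) :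
    IsSmoothOneForm θ := by
  intro x
  obtain ⟨A, B, hA, hB, hAB⟩ := g.exists_frame hE x
  have hx := hAB.self_of_nhds
  have J_ne {V : Π x : X, TangentSpace 𝓘(ℝ, E) x} (hV : V x ≠ 0) : J x (V x) ≠ 0 := by
    intro h0
    apply hV
    rw [← neg_eq_zero, ← J_J, h0, map_zero]
  have hform {V : Π x : X, TangentSpace 𝓘(ℝ, E) x} (hV : IsSmoothVectorField V) :
      ContMDiffAt 𝓘(ℝ, E) (𝓘(ℝ, E).prod 𝓘(ℝ, E →L[ℝ] ℝ)) ∞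
        (fun x ↦ Bundle.TotalSpace.mk' (E →L[ℝ] ℝ)
          (E := fun x : X ↦ TangentSpace 𝓘(ℝ, E) x →L[ℝ] Bundle.Trivial X ℝ x) x
          (g.inner x (V x))) x :=
    ContMDiffAt.clm_bundle_apply (g.contMDiff x) (hV x)
  have s₁ := ContMDiffAt.smul_section
    (g.contMDiffAt_inner_div (h A hA x hx.left_ne_zero) hA hx.left_ne_zero) (hform hA)
  have s₂ := ContMDiffAt.smul_section
    (g.contMDiffAt_inner_div (h _ hA.J x (J_ne hx.left_ne_zero)) hA hx.left_ne_zero) (hform hA.J)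
  have s₃ := ContMDiffAt.smul_section
    (g.contMDiffAt_inner_div (h B hB x hx.right_ne_zero) hB hx.right_ne_zero) (hform hB)
  have s₄ := ContMDiffAt.smul_section
    (g.contMDiffAt_inner_div (h _ hB.J x (J_ne hx.right_ne_zero)) hB hx.right_ne_zero) (hform hB.J)
  refine (((s₁.add_section s₂).add_section s₃).add_section s₄).congr_of_eventuallyEq ?_
  filter_upwards [hAB] with y hy
  refine congrArg (Bundle.TotalSpace.mk' (E →L[ℝ] ℝ) y) ?_
  ext v
  change θ y v = θ y (A y) / g.inner y (A y) (A y) * g.inner y (A y) v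
    + θ y (J y (A y)) / g.inner y (A y) (A y) * g.inner y (J y (A y)) v
    + θ y (B y) / g.inner y (B y) (B y) * g.inner y (B y) v
    + θ y (J y (B y)) / g.inner y (B y) (B y) * g.inner y (J y (B y)) v
  conv_lhs => rw [g.eq_sum_of_isOrthogonalPair y hE hy v]
  simp only [map_add, map_smul, smul_eq_mul, g.inner_comm y _ v]
  ring

omit [FiniteDimensional ℂ E] [T2Space X] in
lemma IsSmoothOneForm.apply {θ : Π x : X, TangentSpace 𝓘(ℝ, E) x →L[ℝ] ℝ}
    (hθ : IsSmoothOneForm θ) (hV : IsSmoothVectorField V) :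
    IsSmoothFunction (E := E) fun x ↦ θ x (V x) := by
  intro x
  have := ContMDiffAt.clm_bundle_apply (hθ x) (hV x)
  exact (Bundle.contMDiffAt_section x).1 this

end Frames

/-! ### Smoothness of ω, of the torsion form and of covariant derivatives. -/

section Smoothness

variable [FiniteDimensional ℂ E]

omit [FiniteDimensional ℂ E] in
lemma isSmoothFunction_fundamentalForm (g : HermitianMetric E X) (hV : IsSmoothVectorField V)
    (hW : IsSmoothVectorField W) :
    IsSmoothFunction (E := E) (fun x ↦ g.fundamentalForm x (V x) (W x)) :=
  g.isSmoothFunction_inner hV hW.J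

omit [FiniteDimensional ℂ E] in
lemma fundamentalForm_swap (g : HermitianMetric E X) (x : X) (u v : TangentSpace 𝓘(ℝ, E) x) :
    g.fundamentalForm x u v = -g.fundamentalForm x v u := by
  rw [fundamentalForm, g.inner_J_right, g.inner_comm, fundamentalForm]

omit [FiniteDimensional ℂ E] in
lemma fundamentalForm_J_J (g : HermitianMetric E X) (x : X) (u v : TangentSpace 𝓘(ℝ, E) x) :
    g.fundamentalForm x (J x u) (J x v) = g.fundamentalForm x u v := by
  rw [fundamentalForm, g.inner_J_J, fundamentalForm]

omit [FiniteDimensional ℂ E] in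
lemma isSmoothFunction_leeTorsion (g : HermitianMetric E X)
    {θ : Π x : X, TangentSpace 𝓘(ℝ, E) x →L[ℝ] ℝ}
    (hθ : ∀ V, IsSmoothVectorField V → IsSmoothFunction (E := E) fun x ↦ θ x (V x))
    (hU : IsSmoothVectorField U) (hV : IsSmoothVectorField V) (hW : IsSmoothVectorField W) :
    IsSmoothFunction (E := E) (fun x ↦ g.leeTorsion x (θ x) (U x) (V x) (W x)) :=
  ((((hθ _ hU.J).mul (g.isSmoothFunction_fundamentalForm hV hW)).add
    ((hθ _ hV.J).mul (g.isSmoothFunction_fundamentalForm hW hU))).add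
    ((hθ _ hW.J).mul (g.isSmoothFunction_fundamentalForm hU hV))).neg

variable {D : AffineConnection E X}

/-- Smoothness is derived rather than assumed: the Koszul formula writes g(∇_U V, W) through the
metric, brackets and torsion. -/
lemma IsMetricConnection.isSmoothVectorField_along [T2Space X] (hD : g.IsMetricConnection D)
    (hE : Module.finrank ℂ E = 2)
    (hT : ∀ U V W, IsSmoothVectorField U → IsSmoothVectorField V → IsSmoothVectorField W →
      IsSmoothFunction (E := E) fun x ↦ g.torsionForm D x (U x) (V x) (W x))
    (hU : IsSmoothVectorField U) (hV : IsSmoothVectorField V) :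
    IsSmoothVectorField (D.along U V) := by
  refine g.isSmoothVectorField_of_inner hE fun W hW ↦ ?_
  have h2 : IsSmoothFunction (E := E) (fun x ↦ 2 * g.inner x (D.along U V x) (W x)) := by
    simp only [fun x ↦ hD.koszul hU hV hW x]
    exact ((((((((hU.deriv (g.isSmoothFunction_inner hV hW)).add
      (hV.deriv (g.isSmoothFunction_inner hU hW))).sub
      (hW.deriv (g.isSmoothFunction_inner hU hV))).add
      (g.isSmoothFunction_inner (hU.bracket hV) hW)).sub
      (g.isSmoothFunction_inner (hU.bracket hW) hV)).sub
      (g.isSmoothFunction_inner (hV.bracket hW) hU)).add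
      (hT U V W hU hV hW)).sub (hT U W V hU hW hV)).sub (hT V W U hV hW hU)
  have h3 : IsSmoothFunction (E := E)
      (fun x ↦ (1 / 2 : ℝ) * (2 * g.inner x (D.along U V x) (W x))) :=
    ContMDiff.mul contMDiff_const h2
  refine h3.congr fun x ↦ ?_
  ring

end Smoothness

/-! ### Curvature and exterior derivative in terms of ∇T. -/

section Identities

variable [FiniteDimensional ℂ E] {D : AffineConnection E X}

lemma deriv_fundamentalForm (hD : g.IsMetricConnection D) (hJ : D.PreservesJ)
    (hU : IsSmoothVectorField U) (hV : IsSmoothVectorField V) (hW : IsSmoothVectorField W) (x : X) :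
    deriv U (fun y ↦ g.fundamentalForm y (V y) (W y)) x =
      g.fundamentalForm x (D.along U V x) (W x) + g.fundamentalForm x (V x) (D.along U W x) := by
  simp only [fundamentalForm]
  rw [hD.deriv_inner U hV hW.J, hJ U W hU hW]

/-- The covariant derivative of the torsion form. -/
def nablaTorsion (g : HermitianMetric E X) (D : AffineConnection E X)
    (U V W Z : Π x : X, TangentSpace 𝓘(ℝ, E) x) (x : X) : ℝ :=
  deriv U (fun y ↦ g.torsionForm D y (V y) (W y) (Z y)) x
    - g.torsionForm D x (D.along U V x) (W x) (Z x)
    + g.torsionForm D x (D.along U W x) (V x) (Z x)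
    - g.torsionForm D x (D.along U Z x) (V x) (W x)

/-- The covariant derivative of a `1`-form. -/
def nablaForm (D : AffineConnection E X) (θ : Π x : X, TangentSpace 𝓘(ℝ, E) x →L[ℝ] ℝ)
    (U V : Π x : X, TangentSpace 𝓘(ℝ, E) x) (x : X) : ℝ :=
  deriv U (fun y ↦ θ y (V y)) x - θ x (D.along U V x)

/-- Because ∇J = 0 and ∇ω = 0, the Leibniz rule differentiates only θ, so ∇T = -((∇θ)∘J) ∧ ω. -/
lemma nablaTorsion_eq_of_leeTorsion (hD : g.IsMetricConnection D) (hJ : D.PreservesJ)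
    {θ : Π x : X, TangentSpace 𝓘(ℝ, E) x →L[ℝ] ℝ}
    (hθ : ∀ V, IsSmoothVectorField V → IsSmoothFunction (E := E) fun x ↦ θ x (V x))
    (hT : ∀ x u v w, g.torsionForm D x u v w = g.leeTorsion x (θ x) u v w)
    (hU : IsSmoothVectorField U) (hV : IsSmoothVectorField V) (hW : IsSmoothVectorField W)
    (hZ : IsSmoothVectorField Z) (x : X) :
    g.nablaTorsion D U V W Z x =
      -(nablaForm D θ U (fun y ↦ J y (V y)) x * g.fundamentalForm x (W x) (Z x)
        + nablaForm D θ U (fun y ↦ J y (W y)) x * g.fundamentalForm x (Z x) (V x)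
        + nablaForm D θ U (fun y ↦ J y (Z y)) x * g.fundamentalForm x (V x) (W x)) := by
  simp only [nablaTorsion, hT, leeTorsion, nablaForm]
  have a₁ := IsSmoothFunction.fun_mul (hθ _ hV.J) (g.isSmoothFunction_fundamentalForm hW hZ)
  have a₂ := IsSmoothFunction.fun_mul (hθ _ hW.J) (g.isSmoothFunction_fundamentalForm hZ hV)
  have a₃ := IsSmoothFunction.fun_mul (hθ _ hZ.J) (g.isSmoothFunction_fundamentalForm hV hW)
  rw [deriv_neg, deriv_add (IsSmoothFunction.fun_add a₁ a₂) a₃, deriv_add a₁ a₂,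
    deriv_mul (hθ _ hV.J) (g.isSmoothFunction_fundamentalForm hW hZ),
    deriv_mul (hθ _ hW.J) (g.isSmoothFunction_fundamentalForm hZ hV),
    deriv_mul (hθ _ hZ.J) (g.isSmoothFunction_fundamentalForm hV hW),
    deriv_fundamentalForm hD hJ hU hW hZ, deriv_fundamentalForm hD hJ hU hZ hV,
    deriv_fundamentalForm hD hJ hU hV hW, hJ U V hU hV, hJ U W hU hW, hJ U Z hU hZ]
  rw [g.fundamentalForm_swap x (V x) (Z x), g.fundamentalForm_swap x (D.along U W x) (V x),
    g.fundamentalForm_swap x (Z x) (D.along U W x), g.fundamentalForm_swap x (D.along U Z x) (V x),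
    g.fundamentalForm_swap x (W x) (D.along U Z x)]
  ring

omit g in
-- Second derivatives are grouped by their outer direction; each remaining derivative along a
-- bracket is rewritten through the torsion, and the iterated brackets cancel by the Jacobi
-- identity.
lemma cyclicSum_curvature (hUV : IsSmoothVectorField (D.along U V))
    (hVU : IsSmoothVectorField (D.along V U)) (hVW : IsSmoothVectorField (D.along V W))
    (hWV : IsSmoothVectorField (D.along W V)) (hWU : IsSmoothVectorField (D.along W U))
    (hUW : IsSmoothVectorField (D.along U W))
    (hU : IsSmoothVectorField U) (hV : IsSmoothVectorField V) (hW : IsSmoothVectorField W)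
    (x : X) :
    (D.curvature U V W + D.curvature V W U + D.curvature W U V) x =
      D.along U (D.along V W - D.along W V - bracket V W) x
        + D.along V (D.along W U - D.along U W - bracket W U) x
        + D.along W (D.along U V - D.along V U - bracket U V) x
        + D.torsion x (U x) (bracket V W x) + D.torsion x (V x) (bracket W U x)
        + D.torsion x (W x) (bracket U V x) := by
  have h₁ := D.bracket_eq hU (hV.bracket hW) x
  have h₂ := D.bracket_eq hV (hW.bracket hU) x
  have h₃ := D.bracket_eq hW (hU.bracket hV) x
  have hjac := jacobi hU hV hW x
  rw [D.along_sub (hVW.sub hWV) (hV.bracket hW), D.along_sub hVW hWV,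
    D.along_sub (hWU.sub hUW) (hW.bracket hU), D.along_sub hWU hUW,
    D.along_sub (hUV.sub hVU) (hU.bracket hV), D.along_sub hUV hVU]
  have e₁ : bracket (bracket U V) W x = -bracket W (bracket U V) x := bracket_swap _ _ x
  have e₂ : bracket V (bracket U W) x = -bracket V (bracket W U) x := by
    have : bracket U W = -bracket W U := funext (bracket_swap U W)
    rw [h₂, this, D.bracket_eq hV (hW.bracket hU).neg, D.along_neg (hW.bracket hU)]
    simp only [AffineConnection.along, Pi.neg_apply, map_neg]
    abel
  simp only [AffineConnection.curvature, Pi.add_apply, Pi.sub_apply]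
  rw [e₁, e₂, h₁, h₂, h₃] at hjac
  rw [← sub_eq_zero] at hjac ⊢
  refine Eq.trans ?_ hjac
  abel

/-- The first Bianchi identity with torsion. Total skewness turns the terms T(·, T(·,·)) into inner
products of two torsion values. -/
lemma inner_cyclicSum_curvature (hD : g.IsMetricConnection D)
    (hT : ∀ x u v w, g.torsionForm D x u v w = -g.torsionForm D x u w v)
    (hs : ∀ U V, IsSmoothVectorField U → IsSmoothVectorField V →
      IsSmoothVectorField (D.along U V))
    (hU : IsSmoothVectorField U) (hV : IsSmoothVectorField V) (hW : IsSmoothVectorField W)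
    (hZ : IsSmoothVectorField Z) (x : X) :
    g.inner x ((D.curvature U V W + D.curvature V W U + D.curvature W U V) x) (Z x) =
      g.nablaTorsion D U V W Z x + g.nablaTorsion D V W U Z x + g.nablaTorsion D W U V Z x
        + (g.inner x (D.torsion x (U x) (V x)) (D.torsion x (W x) (Z x))
        + g.inner x (D.torsion x (V x) (W x)) (D.torsion x (U x) (Z x))
        + g.inner x (D.torsion x (W x) (U x)) (D.torsion x (V x) (Z x))) := by
  have key {U V W : Π x : X, TangentSpace 𝓘(ℝ, E) x} (hU : IsSmoothVectorField U)
      (hV : IsSmoothVectorField V) (hW : IsSmoothVectorField W) :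
      g.inner x (D.along U (D.along V W - D.along W V - bracket V W) x) (Z x) =
        deriv U (fun y ↦ g.torsionForm D y (V y) (W y) (Z y)) x
          - g.torsionForm D x (V x) (W x) (D.along U Z x) := by
    -- The differentiated field is T(V,W), so metric compatibility produces the derivative of
    -- T(V,W,Z).
    have hτ (y : X) : (D.along V W - D.along W V - bracket V W) y = D.torsion y (V y) (W y) := by
      simp only [Pi.sub_apply]
      rw [D.bracket_eq hV hW]
      abel
    have h := hD.deriv_inner U (((hs V W hV hW).sub (hs W V hW hV)).sub (hV.bracket hW)) hZ x
    simp only [hτ] at h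
    simp only [torsionForm]
    rw [h]
    ring
  have s₁ (u v w) : g.torsionForm D x u v w = -g.torsionForm D x v u w := by
    simp [torsionForm, D.torsion_antisymm u v]
  have s₂ (u v w z) : g.torsionForm D x u (D.torsion x v w) z =
      -g.inner x (D.torsion x v w) (D.torsion x u z) := by
    rw [hT, torsionForm, g.inner_comm]
  rw [cyclicSum_curvature (hs U V hU hV) (hs V U hV hU) (hs V W hV hW) (hs W V hW hV)
    (hs W U hW hU) (hs U W hU hW) hU hV hW]
  simp only [map_add, _root_.add_apply]
  rw [key hU hV hW, key hV hW hU, key hW hU hV]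
  change _ + g.torsionForm D x _ _ _ + g.torsionForm D x _ _ _ + g.torsionForm D x _ _ _ = _
  rw [D.bracket_eq hU hV, D.bracket_eq hV hW, D.bracket_eq hW hU]
  have m (u v v' z) : g.torsionForm D x u (v - v') z =
      g.torsionForm D x u v z - g.torsionForm D x u v' z := by simp [torsionForm]
  simp only [m, s₂, nablaTorsion]
  rw [s₁ (D.along U V x), s₁ (D.along V W x), s₁ (D.along W U x), s₁ (D.along U W x),
    s₁ (D.along V U x), s₁ (D.along W V x), s₁ (D.along U Z x), s₁ (D.along V Z x),
    s₁ (D.along W Z x), hT x (V x) (D.along U Z x), hT x (W x) (D.along V Z x),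
    hT x (U x) (D.along W Z x)]
  ring

/-- The factor 2 arises because the six brackets pair up: [U,V] and [W,Z], for example, both
contribute g(T(U,V), T(W,Z)). -/
lemma d₃_torsionForm (hT : ∀ x u v w, g.torsionForm D x u v w = -g.torsionForm D x u w v)
    (hU : IsSmoothVectorField U) (hV : IsSmoothVectorField V) (hW : IsSmoothVectorField W)
    (hZ : IsSmoothVectorField Z) (x : X) :
    d₃ (g.torsionForm D) U V W Z x =
      g.nablaTorsion D U V W Z x - g.nablaTorsion D V U W Z x + g.nablaTorsion D W U V Z x
        - g.nablaTorsion D Z U V W x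
        + 2 * (g.inner x (D.torsion x (U x) (V x)) (D.torsion x (W x) (Z x))
        + g.inner x (D.torsion x (V x) (W x)) (D.torsion x (U x) (Z x))
        + g.inner x (D.torsion x (W x) (U x)) (D.torsion x (V x) (Z x))) := by
  have s₁ (u v w) : g.torsionForm D x u v w = -g.torsionForm D x v u w := by
    simp [torsionForm, D.torsion_antisymm u v]
  have s₂ (u v w z) : g.torsionForm D x (D.torsion x u v) w z =
      g.inner x (D.torsion x u v) (D.torsion x w z) := by
    rw [s₁, hT, torsionForm, g.inner_comm]
    ring
  have m (u v w z) : g.torsionForm D x (u - v) w z =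
      g.torsionForm D x u w z - g.torsionForm D x v w z := by simp [torsionForm]
  simp only [d₃, nablaTorsion]
  rw [D.bracket_eq hU hV, D.bracket_eq hU hW, D.bracket_eq hU hZ, D.bracket_eq hV hW,
    D.bracket_eq hV hZ, D.bracket_eq hW hZ]
  simp only [m, s₂]
  rw [g.inner_comm x (D.torsion x (V x) (Z x)), g.inner_comm x (D.torsion x (W x) (Z x)),
    g.inner_comm x (D.torsion x (U x) (Z x)), D.torsion_antisymm (U x) (W x)]
  simp only [map_neg, _root_.neg_apply]
  ring

end Identities

end HermitianMetric
end HermitianGeometry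

namespace HermitianGeometry

variable {E : Type*} [NormedAddCommGroup E] [NormedSpace ℂ E] [FiniteDimensional ℂ E]
  {X : Type*} [TopologicalSpace X] [ChartedSpace E X] [IsManifold 𝓘(ℂ, E) ω X]
  {U V W Z : Π x : X, TangentSpace 𝓘(ℝ, E) x}

namespace HermitianMetric

variable {g : HermitianMetric E X}

/-! ### The Lee form: existence, uniqueness and smoothness. -/

section LeeForm

omit [FiniteDimensional ℂ E] in
-- This fixes the sign in `leeTorsion`: combined with `d₂_fundamentalForm` it yields dω = θ ∧ ω.
lemma leeTorsion_cyclic (g : HermitianMetric E X) (x : X) (θ : TangentSpace 𝓘(ℝ, E) x →L[ℝ] ℝ)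
    (u v w : TangentSpace 𝓘(ℝ, E) x) :
    g.leeTorsion x θ u v (J x w) + g.leeTorsion x θ v w (J x u) + g.leeTorsion x θ w u (J x v) =
      θ u * g.fundamentalForm x v w - θ v * g.fundamentalForm x u w
        + θ w * g.fundamentalForm x u v := by
  have h₁ (u v) : g.fundamentalForm x u (J x v) = -g.inner x u v := by
    simp [fundamentalForm, J_J]
  have h₂ (u v) : g.fundamentalForm x (J x u) v = g.inner x u v := by
    simp [fundamentalForm, g.inner_J_J]
  simp only [leeTorsion, h₁, h₂, J_J, map_neg]
  rw [g.fundamentalForm_swap x w u]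
  ring

variable {D : AffineConnection E X}

/-- For a Hermitian connection, `dω(U, V, W)` is the cyclic sum of `T(U, V, J W)`. -/
lemma d₂_fundamentalForm (hD : g.IsMetricConnection D) (hJ : D.PreservesJ)
    (hU : IsSmoothVectorField U) (hV : IsSmoothVectorField V) (hW : IsSmoothVectorField W) (x : X) :
    d₂ g.fundamentalForm U V W x =
      g.torsionForm D x (U x) (V x) (J x (W x)) + g.torsionForm D x (V x) (W x) (J x (U x))
        + g.torsionForm D x (W x) (U x) (J x (V x)) := by
  have m (u v w) : g.fundamentalForm x (u - v) w =
      g.fundamentalForm x u w - g.fundamentalForm x v w := by simp [fundamentalForm]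
  have t (u v w) : g.torsionForm D x u v (J x w) = g.fundamentalForm x (D.torsion x u v) w := rfl
  rw [d₂, deriv_fundamentalForm hD hJ hU hV hW, deriv_fundamentalForm hD hJ hV hU hW,
    deriv_fundamentalForm hD hJ hW hU hV, D.bracket_eq hU hV, D.bracket_eq hU hW,
    D.bracket_eq hV hW]
  simp only [m, t]
  rw [D.torsion_antisymm (U x) (W x), g.fundamentalForm_swap x (V x) (D.along U W x),
    g.fundamentalForm_swap x (U x), g.fundamentalForm_swap x (U x) (D.along W V x)]
  have n (u w) : g.fundamentalForm x (-u) w = -g.fundamentalForm x u w := by simp [fundamentalForm]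
  rw [n]
  ring

/-- Here θ is chosen point by point; its smoothness is recovered later from dω by
`isSmoothOneForm_of_d₂_eq`. -/
lemma IsBismut.exists_torsionForm_eq (hD : g.IsBismut D) (hE : Module.finrank ℂ E = 2) :
    ∃ θ : Π x : X, TangentSpace 𝓘(ℝ, E) x →L[ℝ] ℝ,
      ∀ x u v w, g.torsionForm D x u v w = g.leeTorsion x (θ x) u v w := by
  choose θ hθ using fun x ↦ g.exists_leeTorsion_eq x hE (D.torsion x)
    (fun u v ↦ D.torsion_antisymm u v) (hD.skew x)
  exact ⟨θ, hθ⟩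

lemma d₂_eq_wedge (hD : g.IsMetricConnection D) (hJ : D.PreservesJ)
    {θ : Π x : X, TangentSpace 𝓘(ℝ, E) x →L[ℝ] ℝ}
    (hT : ∀ x u v w, g.torsionForm D x u v w = g.leeTorsion x (θ x) u v w)
    (hU : IsSmoothVectorField U) (hV : IsSmoothVectorField V) (hW : IsSmoothVectorField W) (x : X) :
    d₂ g.fundamentalForm U V W x =
      wedge₁₂ (fun y v ↦ θ y v) g.fundamentalForm x (U x) (V x) (W x) := by
  rw [d₂_fundamentalForm hD hJ hU hV hW, hT, hT, hT, leeTorsion_cyclic, wedge₁₂]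

omit [FiniteDimensional ℂ E] in
-- Recovers θ from θ ∧ ω, since ω(v,Jv) = -g(v,v) and the other two terms vanish. Both uniqueness
-- and smoothness of the Lee form come from here.
lemma wedge₁₂_of_orthogonal (g : HermitianMetric E X) {x : X}
    (θ : Π x : X, TangentSpace 𝓘(ℝ, E) x →L[ℝ] ℝ) {u v : TangentSpace 𝓘(ℝ, E) x}
    (h : g.inner x u v = 0) (h' : g.inner x (J x u) v = 0) :
    wedge₁₂ (fun y v ↦ θ y v) g.fundamentalForm x u v (J x v) = -(θ x u * g.inner x v v) := by
  simp [wedge₁₂, fundamentalForm, J_J, h, g.inner_J_right x u v, h']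

omit [FiniteDimensional ℂ E] in
lemma eq_of_wedge₁₂_eq (g : HermitianMetric E X) (hE : Module.finrank ℂ E = 2) {x : X}
    {θ θ' : Π x : X, TangentSpace 𝓘(ℝ, E) x →L[ℝ] ℝ}
    (h : ∀ u v w, wedge₁₂ (fun y v ↦ θ y v) g.fundamentalForm x u v w =
      wedge₁₂ (fun y v ↦ θ' y v) g.fundamentalForm x u v w) : θ x = θ' x := by
  ext u
  obtain ⟨e, f, hef, -, hf, r, rfl⟩ := g.exists_orthonormal_pair x hE u
  have e1 : g.inner x (r • e) f = 0 := by simp [hef.inner_eq_zero]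
  have e2 : g.inner x (J x (r • e)) f = 0 := by simp [hef.inner_J_eq_zero]
  have := h (r • e) f (J x f)
  rw [g.wedge₁₂_of_orthogonal θ e1 e2, g.wedge₁₂_of_orthogonal θ' e1 e2, hf] at this
  linarith

lemma isSmoothFunction_d₂ (g : HermitianMetric E X)
    (hU : IsSmoothVectorField U) (hV : IsSmoothVectorField V) (hW : IsSmoothVectorField W) :
    IsSmoothFunction (E := E) (d₂ g.fundamentalForm U V W) :=
  (((((hU.deriv (g.isSmoothFunction_fundamentalForm hV hW)).sub
    (hV.deriv (g.isSmoothFunction_fundamentalForm hU hW))).add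
    (hW.deriv (g.isSmoothFunction_fundamentalForm hU hV))).sub
    (g.isSmoothFunction_fundamentalForm (hU.bracket hV) hW)).add
    (g.isSmoothFunction_fundamentalForm (hU.bracket hW) hV)).sub
    (g.isSmoothFunction_fundamentalForm (hV.bracket hW) hU)

/-- On a Hermitian surface, the Lee form is smooth. -/
lemma isSmoothOneForm_of_d₂_eq [T2Space X] (g : HermitianMetric E X)
    (hE : Module.finrank ℂ E = 2) {θ : Π x : X, TangentSpace 𝓘(ℝ, E) x →L[ℝ] ℝ}
    (h : ∀ U V W, IsSmoothVectorField U → IsSmoothVectorField V → IsSmoothVectorField W →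
      ∀ x, d₂ g.fundamentalForm U V W x =
        wedge₁₂ (fun y v ↦ θ y v) g.fundamentalForm x (U x) (V x) (W x)) :
    IsSmoothOneForm θ := by
  refine g.isSmoothOneForm_of_apply hE fun V hV x hx ↦ ?_
  obtain ⟨W, hW, hVW, hWx⟩ := g.exists_smooth_orthogonal hE hV hx
  -- Near `x`, θ(V) = -dω(V, W, JW) / g(W,W).
  refine (g.contMDiffAt_inner_div (g.isSmoothFunction_d₂ hV hW hW.J x).neg hW
    hWx.right_ne_zero).congr_of_eventuallyEq ?_
  filter_upwards [g.eventually_ne_zero hW hWx.right_ne_zero] with y hy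
  have := (g.pos y _ hy).ne'
  rw [eq_div_iff this, h V W _ hV hW hW.J,
    g.wedge₁₂_of_orthogonal θ (hVW y).1 (hVW y).2]
  ring

end LeeForm

/-! ### From the SKT and Bianchi conditions to Vaisman. -/

section BismutToVaisman

variable [T2Space X] {D D' : AffineConnection E X}

/-- The Bismut connection is unique. -/
lemma IsBismut.along_eq (hD : g.IsBismut D) (hD' : g.IsBismut D') (hE : Module.finrank ℂ E = 2)
    (hU : IsSmoothVectorField U) (hV : IsSmoothVectorField V) : D.along U V = D'.along U V := by
  obtain ⟨θ, hθ⟩ := hD.exists_torsionForm_eq hE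
  obtain ⟨θ', hθ'⟩ := hD'.exists_torsionForm_eq hE
  -- Both wedge products with ω equal dω, which does not involve the connection. The torsions then
  -- agree, and the Koszul formula determines the derivatives.
  have hθθ' (x : X) : θ x = θ' x := by
    refine g.eq_of_wedge₁₂_eq hE fun u v w ↦ ?_
    obtain ⟨A, hA, rfl⟩ := exists_isSmoothVectorField x u
    obtain ⟨B, hB, rfl⟩ := exists_isSmoothVectorField x v
    obtain ⟨C, hC, rfl⟩ := exists_isSmoothVectorField x w
    rw [← d₂_eq_wedge hD.metric hD.complex hθ hA hB hC,
      ← d₂_eq_wedge hD'.metric hD'.complex hθ' hA hB hC]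
  funext x
  refine g.eq_of_inner_eq x fun w ↦ ?_
  obtain ⟨W, hW, rfl⟩ := exists_isSmoothVectorField x w
  have h₁ := hD.metric.koszul hU hV hW x
  have h₂ := hD'.metric.koszul hU hV hW x
  simp only [hθ] at h₁
  simp only [hθ', ← hθθ'] at h₂
  linarith

lemma nablaForm_eq_zero (hE : Module.finrank ℂ E = 2)
    (hD : g.IsMetricConnection D) (hJ : D.PreservesJ)
    {θ : Π x : X, TangentSpace 𝓘(ℝ, E) x →L[ℝ] ℝ} (hθ : IsSmoothOneForm θ)
    (hT : ∀ x u v w, g.torsionForm D x u v w = g.leeTorsion x (θ x) u v w)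
    (hN : ∀ U V W Z, IsSmoothVectorField U → IsSmoothVectorField V → IsSmoothVectorField W →
      IsSmoothVectorField Z → ∀ x, g.nablaTorsion D U V W Z x = 0)
    (hU : IsSmoothVectorField U) (hV : IsSmoothVectorField V) (x : X) :
    nablaForm D θ U V x = 0 := by
  obtain ⟨e, f, h, -, hf, r, hr⟩ := g.exists_orthonormal_pair x hE (V x)
  obtain ⟨W, hW, rfl⟩ := exists_isSmoothVectorField x f
  have e1 : g.inner x (V x) (W x) = 0 := by simp [hr, h.inner_eq_zero]
  have e2 : g.inner x (J x (V x)) (W x) = 0 := by simp [hr, h.inner_J_eq_zero]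
  -- On the triple (-JV, W, JW), with W a unit vector at `x` orthogonal to V and JV, only the term
  -- (∇_U θ)(V) survives.
  have h0 := hN U _ W _ hU hV.neg.J hW hW.J x
  rw [nablaTorsion_eq_of_leeTorsion hD hJ (fun _ h ↦ IsSmoothOneForm.apply hθ h) hT hU hV.neg.J hW
    hW.J] at h0
  simp only [J_J, Pi.neg_apply, neg_neg] at h0
  have w₁ : g.fundamentalForm x (W x) (J x (W x)) = -1 := by simp [fundamentalForm, J_J, hf]
  have w₂ : g.fundamentalForm x (J x (W x)) (J x (-V x)) = 0 := by
    rw [fundamentalForm_J_J, fundamentalForm, map_neg, map_neg, g.inner_comm, e2, neg_zero]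
  have w₃ : g.fundamentalForm x (J x (-V x)) (W x) = 0 := by
    rw [fundamentalForm, g.inner_J_J, map_neg, _root_.neg_apply, e1, neg_zero]
  rw [w₁, w₂, w₃] at h0
  linarith

lemma IsMetricConnection.isSmoothVectorField_along_of_leeTorsion (hD : g.IsMetricConnection D)
    (hE : Module.finrank ℂ E = 2)
    {θ : Π x : X, TangentSpace 𝓘(ℝ, E) x →L[ℝ] ℝ} (hθ : IsSmoothOneForm θ)
    (hT : ∀ x u v w, g.torsionForm D x u v w = g.leeTorsion x (θ x) u v w)
    (hU : IsSmoothVectorField U) (hV : IsSmoothVectorField V) :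
    IsSmoothVectorField (D.along U V) := by
  refine hD.isSmoothVectorField_along hE (fun A B C hA hB hC ↦ ?_) hU hV
  simp only [hT]
  exact g.isSmoothFunction_leeTorsion (fun _ h ↦ IsSmoothOneForm.apply hθ h) hA hB hC

omit [T2Space X] in
/-- The Levi-Civita connection, obtained from a metric connection with skew torsion. -/
lemma IsBismut.isLeviCivita_addOneForm (hD : g.IsBismut D) :
    g.IsLeviCivita (D.addOneForm fun x ↦ (1 / 2 : ℝ) • D.torsion x) := by
  -- With the field as first argument, the new connection is ∇_V W - T(V,W)/2, and the correction
  -- lowers the torsion by exactly T.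
  refine ⟨hD.metric.addOneForm _ fun x u v w ↦ ?_, ?_⟩
  · have h₁ := hD.skew x u v w
    have h₂ : g.torsionForm D x w v u = -g.torsionForm D x v w u := by
      simp [torsionForm, D.torsion_antisymm w v]
    have h₃ := hD.skew x v w u
    have h₄ : g.torsionForm D x v u w = -g.torsionForm D x u v w := by
      simp [torsionForm, D.torsion_antisymm v u]
    simp only [torsionForm] at h₁ h₂ h₃ h₄
    simp only [_root_.smul_apply, map_smul, smul_eq_mul]
    rw [g.inner_comm x u]
    linarith
  · ext x u v
    rw [torsion_addOneForm]
    simp only [_root_.smul_apply, Pi.zero_apply, _root_.zero_apply]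
    rw [D.torsion_antisymm v u]
    module

theorem isVaisman_of_isSKT_of_firstBianchi (hE : Module.finrank ℂ E = 2) (h₁ : g.IsSKT)
    (h₂ : g.BismutFirstBianchi) : g.IsVaisman := by
  obtain ⟨D, hD, hd⟩ := h₁
  obtain ⟨D', hD', hb⟩ := h₂
  obtain ⟨θ, hT⟩ := hD.exists_torsionForm_eq hE
  have hω (A B C) (hA : IsSmoothVectorField A) (hB : IsSmoothVectorField B)
      (hC : IsSmoothVectorField C) := d₂_eq_wedge hD.metric hD.complex hT hA hB hC
  have hθ : IsSmoothOneForm θ := g.isSmoothOneForm_of_d₂_eq hE hω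
  have hs (A B) (hA : IsSmoothVectorField A) (hB : IsSmoothVectorField B) :=
    IsMetricConnection.isSmoothVectorField_along_of_leeTorsion hD.metric hE hθ hT hA hB
  -- The two hypotheses supply possibly different Bismut connections; uniqueness on smooth fields
  -- transfers the Bianchi identity to `D`.
  have hcurv {A B C : Π x : X, TangentSpace 𝓘(ℝ, E) x} (hA : IsSmoothVectorField A)
      (hB : IsSmoothVectorField B) (hC : IsSmoothVectorField C) :
      D'.curvature A B C = D.curvature A B C := by
    simp only [AffineConnection.curvature]
    rw [hD'.along_eq hD hE hB hC, hD'.along_eq hD hE hA hC, hD'.along_eq hD hE hA (hs B C hB hC),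
      hD'.along_eq hD hE hB (hs A C hA hC), hD'.along_eq hD hE (hA.bracket hB) hC]
  -- With the quadratic term gone, Bianchi kills the cyclic sum over B, C, F, and dT(B,C,F,A) = 0
  -- leaves only (∇_A T)(B,C,F).
  have hN (A B C F : Π x : X, TangentSpace 𝓘(ℝ, E) x) (hA : IsSmoothVectorField A)
      (hB : IsSmoothVectorField B) (hC : IsSmoothVectorField C) (hF : IsSmoothVectorField F)
      (x : X) : g.nablaTorsion D A B C F x = 0 := by
    have b := inner_cyclicSum_curvature hD.metric hD.skew hs hB hC hF hA x
    have hb0 := hb B C F hB hC hF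
    rw [hcurv hB hC hF, hcurv hC hF hB, hcurv hF hB hC] at hb0
    have d := d₃_torsionForm hD.skew hB hC hF hA x
    rw [hd B C F A hB hC hF hA] at d
    rw [hb0] at b
    have S := g.sum_inner_torsion_eq_zero x hE (hT x) (B x) (C x) (F x) (A x)
    have swap : g.nablaTorsion D C F B A x = -g.nablaTorsion D C B F A x := by
      have s₁ (y u v w) : g.torsionForm D y u v w = -g.torsionForm D y v u w := by
        simp [torsionForm, D.torsion_antisymm u v]
      have hf : (fun y ↦ g.torsionForm D y (F y) (B y) (A y)) =
          fun y ↦ -g.torsionForm D y (B y) (F y) (A y) := funext fun y ↦ s₁ y _ _ _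
      rw [nablaTorsion, nablaTorsion, hf, deriv_neg, hD.skew x (D.along C A x) (F x) (B x)]
      ring
    rw [swap] at b
    simp only [Pi.zero_apply, map_zero, _root_.zero_apply] at b
    linarith
  have hα (A B) (hA : IsSmoothVectorField A) (hB : IsSmoothVectorField B) (x : X) :=
    nablaForm_eq_zero hE hD.metric hD.complex hθ hT hN hA hB x
  have hpar : AffineConnection.IsParallelOneForm
      (D.addOneForm fun x ↦ (1 / 2 : ℝ) • D.torsion x) θ := by
    intro A B hA hB x
    have h0 := hα A B hA hB x
    -- θ vanishes on torsion values, so passing from ∇ᴮ to ∇ᴸᶜ does not change ∇θ.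
    have h1 := g.leeTorsion_inner_eq_zero x hE (hT x) (B x) (A x)
    change _ - θ x (D B x (A x) + (1 / 2 : ℝ) • D.torsion x (B x) (A x)) = 0
    rw [map_add, map_smul, h1, smul_zero, add_zero]
    exact h0
  have hLC := hD.isLeviCivita_addOneForm
  refine ⟨θ, hθ, fun A B hA hB x ↦ ?_, hω, _, hLC, hpar⟩
  -- For a torsion-free connection dθ is the skew part of ∇θ, hence zero.
  have p₁ := hpar A B hA hB x
  have p₂ := hpar B A hB hA x
  rw [d₁, AffineConnection.bracket_eq _ hA hB, hLC.torsion_eq_zero]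
  simp only [map_sub, Pi.zero_apply, _root_.zero_apply, map_zero]
  linarith

end BismutToVaisman

end HermitianMetric
end HermitianGeometry

namespace HermitianGeometry

variable {E : Type*} [NormedAddCommGroup E] [NormedSpace ℂ E] [FiniteDimensional ℂ E]
  {X : Type*} [TopologicalSpace X] [ChartedSpace E X] [IsManifold 𝓘(ℂ, E) ω X]
  {U V W Z : Π x : X, TangentSpace 𝓘(ℝ, E) x}

namespace HermitianMetric

variable {g : HermitianMetric E X} {D : AffineConnection E X}

/-! ### The covariant derivative of J under the Levi-Civita connection. -/

section NablaJ

/-- The covariant derivative `(∇_V J) W` of the complex structure. -/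
def nablaJ (D : AffineConnection E X) (V W : Π x : X, TangentSpace 𝓘(ℝ, E) x) (x : X) :
    TangentSpace 𝓘(ℝ, E) x :=
  D.along V (fun y ↦ J y (W y)) x - J x (D.along V W x)

omit [FiniteDimensional ℂ E] in
-- Differentiating J² = -1 shows that ∇J anticommutes with J.
lemma nablaJ_J (hW : IsSmoothVectorField W) (x : X) :
    nablaJ D V (fun y ↦ J y (W y)) x = -J x (nablaJ D V W x) := by
  have h : (fun y ↦ J y (J y (W y))) = -W := by
    funext y
    simp [J_J]
  rw [nablaJ, nablaJ, h, D.along_neg hW, map_sub, J_J]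
  abel

/-- J is skew-adjoint and the metric is parallel, so ∇J is skew-adjoint as well. -/
lemma inner_nablaJ_swap (hD : g.IsMetricConnection D)
    (hW : IsSmoothVectorField W) (hZ : IsSmoothVectorField Z) (x : X) :
    g.inner x (nablaJ D V W x) (Z x) = -g.inner x (nablaJ D V Z x) (W x) := by
  have h : (fun y ↦ g.inner y (J y (W y)) (Z y)) = fun y ↦ -g.inner y (W y) (J y (Z y)) := by
    funext y
    rw [g.inner_J_right, neg_neg]
  have h₁ := hD.deriv_inner V hW.J hZ x
  rw [h, deriv_neg, hD.deriv_inner V hW hZ.J x] at h₁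
  simp only [nablaJ, map_sub, _root_.sub_apply]
  rw [g.inner_J_right x (D.along V W x)] at h₁
  rw [g.inner_comm x _ (W x), g.inner_comm x (J x (D.along V Z x)), g.inner_J_right x (W x)]
  linarith

lemma deriv_fundamentalForm_eq (hD : g.IsMetricConnection D)
    (hV : IsSmoothVectorField V) (hW : IsSmoothVectorField W) (x : X) :
    deriv U (fun y ↦ g.fundamentalForm y (V y) (W y)) x =
      g.fundamentalForm x (D.along U V x) (W x) + g.fundamentalForm x (V x) (D.along U W x)
        + g.inner x (nablaJ D U W x) (V x) := by
  simp only [fundamentalForm]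
  rw [hD.deriv_inner U hV hW.J, nablaJ, g.inner_comm x _ (V x), map_sub]
  ring

/-- The vanishing Nijenhuis tensor, with brackets expanded by a torsion-free connection. -/
lemma nablaJ_nijenhuis (hT : D.torsion = 0) (hV : IsSmoothVectorField V)
    (hW : IsSmoothVectorField W) (x : X) :
    nablaJ D (fun y ↦ J y (V y)) W x - nablaJ D (fun y ↦ J y (W y)) V x =
      J x (nablaJ D V W x) - J x (nablaJ D W V x) := by
  have h := nijenhuis hV hW x
  rw [D.bracket_eq hV.J hW.J, D.bracket_eq hV.J hW, D.bracket_eq hV hW.J, D.bracket_eq hV hW,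
    hT] at h
  simp only [Pi.zero_apply, _root_.zero_apply, sub_zero, map_sub] at h
  simp only [nablaJ, map_sub, J_J]
  rw [← sub_eq_zero] at h ⊢
  rw [← h]
  abel

lemma IsLeviCivita.d₂_fundamentalForm (hD : g.IsLeviCivita D)
    (hU : IsSmoothVectorField U) (hV : IsSmoothVectorField V) (hW : IsSmoothVectorField W) (x : X) :
    d₂ g.fundamentalForm U V W x =
      -(g.inner x (nablaJ D U V x) (W x) + g.inner x (nablaJ D V W x) (U x)
        + g.inner x (nablaJ D W U x) (V x)) := by
  have m (u v w) : g.fundamentalForm x (u - v) w =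
      g.fundamentalForm x u w - g.fundamentalForm x v w := by simp [fundamentalForm]
  rw [d₂, deriv_fundamentalForm_eq hD.metric hV hW, deriv_fundamentalForm_eq hD.metric hU hW,
    deriv_fundamentalForm_eq hD.metric hU hV, D.bracket_eq hU hV, D.bracket_eq hU hW,
    D.bracket_eq hV hW, hD.torsion_eq_zero]
  simp only [m, Pi.zero_apply, _root_.zero_apply, sub_zero]
  rw [g.fundamentalForm_swap x (V x) (D.along U W x),
    g.fundamentalForm_swap x (U x), g.fundamentalForm_swap x (U x) (D.along W V x),
    inner_nablaJ_swap hD.metric hW hV, inner_nablaJ_swap hD.metric hV hU]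
  ring

/-- Both values of dω are cyclic sums of ∇J; the terms not differentiated along U cancel by
`nablaJ_nijenhuis` paired with JU. Integrability thus makes dω determine ∇J. -/
lemma IsLeviCivita.two_mul_inner_nablaJ (hD : g.IsLeviCivita D)
    (hU : IsSmoothVectorField U) (hV : IsSmoothVectorField V) (hW : IsSmoothVectorField W) (x : X) :
    2 * g.inner x (nablaJ D U V x) (W x) =
      d₂ g.fundamentalForm U (fun y ↦ J y (V y)) (fun y ↦ J y (W y)) x
        - d₂ g.fundamentalForm U V W x := by
  have h := congrArg (fun u ↦ g.inner x u (J x (U x))) (nablaJ_nijenhuis hD.torsion_eq_zero hV hW x)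
  simp only [map_sub, _root_.sub_apply, g.inner_J_J] at h
  rw [hD.d₂_fundamentalForm hU hV.J hW.J, hD.d₂_fundamentalForm hU hV hW, nablaJ_J hV, nablaJ_J hW,
    inner_nablaJ_swap hD.metric hU hV.J, nablaJ_J hV, inner_nablaJ_swap hD.metric hU hV]
  simp only [map_neg, _root_.neg_apply, g.inner_J_J]
  rw [g.inner_J_right] at h
  rw [g.inner_J_right] at h
  linarith

end NablaJ

/-! ### From Vaisman to the SKT and Bianchi conditions. -/

section VaismanToBismut

omit [FiniteDimensional ℂ E] in
-- The algebraic form of ∇ᴮJ = 0: the two wedge terms are twice ∇ᴸᶜJ, and the two torsion terms are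
-- twice the correction.
lemma wedge₁₂_add_leeTorsion (g : HermitianMetric E X) (x : X)
    (θ : Π x : X, TangentSpace 𝓘(ℝ, E) x →L[ℝ] ℝ) (u v w : TangentSpace 𝓘(ℝ, E) x) :
    wedge₁₂ (fun y v ↦ θ y v) g.fundamentalForm x u (J x v) (J x w)
        - wedge₁₂ (fun y v ↦ θ y v) g.fundamentalForm x u v w
        + g.leeTorsion x (θ x) u (J x v) w + g.leeTorsion x (θ x) u v (J x w) = 0 := by
  have h : g.fundamentalForm x (J x v) w = -g.fundamentalForm x v (J x w) := by
    simp [fundamentalForm, J_J, g.inner_J_J]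
  simp only [wedge₁₂, leeTorsion, J_J, map_neg, fundamentalForm_J_J]
  rw [g.fundamentalForm_swap x w u, g.fundamentalForm_swap x (J x w) u, h]
  ring

omit [FiniteDimensional ℂ E] in
lemma leeTorsion_swap (g : HermitianMetric E X) (x : X) (θ : TangentSpace 𝓘(ℝ, E) x →L[ℝ] ℝ)
    (u v w : TangentSpace 𝓘(ℝ, E) x) :
    g.leeTorsion x θ u v w = -g.leeTorsion x θ v u w := by
  rw [leeTorsion, leeTorsion, g.fundamentalForm_swap x v w, g.fundamentalForm_swap x w u,
    g.fundamentalForm_swap x u v]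
  ring

omit [FiniteDimensional ℂ E] in
lemma leeTorsion_swap_right (g : HermitianMetric E X) (x : X)
    (θ : TangentSpace 𝓘(ℝ, E) x →L[ℝ] ℝ) (u v w : TangentSpace 𝓘(ℝ, E) x) :
    g.leeTorsion x θ u v w = -g.leeTorsion x θ u w v := by
  rw [leeTorsion, leeTorsion, g.fundamentalForm_swap x v w, g.fundamentalForm_swap x w u,
    g.fundamentalForm_swap x u v]
  ring

/-- If `dω = θ ∧ ω`, then the Bismut connection is `∇ᴸᶜ + τ / 2`, where the torsion `τ` is given
by `leeTorsion`. -/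
lemma IsLeviCivita.isBismut_addOneForm [T2Space X] (hD : g.IsLeviCivita D)
    {θ : Π x : X, TangentSpace 𝓘(ℝ, E) x →L[ℝ] ℝ}
    (hω : ∀ U V W : Π x : X, TangentSpace 𝓘(ℝ, E) x,
      IsSmoothVectorField U → IsSmoothVectorField V → IsSmoothVectorField W →
        ∀ x, d₂ g.fundamentalForm U V W x =
          wedge₁₂ (fun y v ↦ θ y v) g.fundamentalForm x (U x) (V x) (W x))
    {τ : Π x : X, TangentSpace 𝓘(ℝ, E) x →L[ℝ]
      TangentSpace 𝓘(ℝ, E) x →L[ℝ] TangentSpace 𝓘(ℝ, E) x}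
    (hτ : ∀ x u v w, g.inner x (τ x u v) w = g.leeTorsion x (θ x) u v w) :
    g.IsBismut (D.addOneForm fun x ↦ (-(1 / 2) : ℝ) • τ x) ∧
      ∀ x u v w, g.torsionForm (D.addOneForm fun x ↦ (-(1 / 2) : ℝ) • τ x) x u v w =
        g.leeTorsion x (θ x) u v w := by
  -- The constant -1/2 reflects the argument order of `addOneForm`: the new connection is ∇_V W +
  -- τ(V,W)/2.
  have hT (x u v w) : g.torsionForm (D.addOneForm fun x ↦ (-(1 / 2) : ℝ) • τ x) x u v w =
      g.leeTorsion x (θ x) u v w := by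
    rw [torsionForm, torsion_addOneForm, hD.torsion_eq_zero]
    simp only [_root_.smul_apply, Pi.zero_apply, _root_.zero_apply, map_sub, map_add, map_smul,
      _root_.sub_apply, _root_.add_apply, hτ, smul_eq_mul, map_zero]
    rw [g.leeTorsion_swap x _ v u]
    ring
  refine ⟨⟨hD.metric.addOneForm _ fun x u v w ↦ ?_, fun V W hV hW x ↦ ?_, fun x u v w ↦ ?_⟩, hT⟩
  · rw [g.inner_comm x u]
    simp only [_root_.smul_apply, map_smul, hτ, smul_eq_mul]
    rw [g.leeTorsion_swap_right x _ u, g.leeTorsion_swap x _ u, g.leeTorsion_swap_right x _ w]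
    ring
  · refine g.eq_of_inner_eq x fun z ↦ ?_
    obtain ⟨Z, hZ, rfl⟩ := exists_isSmoothVectorField x z
    change g.inner x (D.along V (fun y ↦ J y (W y)) x + (-(1 / 2) : ℝ) • τ x (J x (W x)) (V x)) _ =
      g.inner x (J x (D.along V W x + (-(1 / 2) : ℝ) • τ x (W x) (V x))) _
    have h := hD.two_mul_inner_nablaJ hV hW hZ x
    rw [hω _ _ _ hV hW.J hZ.J, hω _ _ _ hV hW hZ, nablaJ] at h
    have h' := g.wedge₁₂_add_leeTorsion x θ (V x) (W x) (Z x)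
    have h'' := g.inner_J_right x (τ x (W x) (V x)) (Z x)
    rw [hτ, g.leeTorsion_swap] at h''
    rw [g.leeTorsion_swap x _ (V x)] at h'
    simp only [map_add, map_sub, map_smul, _root_.add_apply, _root_.sub_apply, _root_.smul_apply,
      smul_eq_mul, hτ] at h ⊢
    linarith
  · rw [hT, hT, g.leeTorsion_swap_right]

theorem IsVaisman.isSKT_and_firstBianchi [T2Space X] (hE : Module.finrank ℂ E = 2)
    (h : g.IsVaisman) : g.IsSKT ∧ g.BismutFirstBianchi := by
  obtain ⟨θ, hθ, -, hω, D₀, hD₀, hpar⟩ := h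
  -- A pointwise choice suffices: smoothness of the resulting covariant derivatives follows from the
  -- Koszul formula, because θ is smooth.
  choose τ hτ using fun x ↦ g.exists_leeTorsion x hE (θ x)
  obtain ⟨D, hDD₀, hD, hT⟩ : ∃ D : AffineConnection E X,
      (∀ V W x, D.along V W x = D₀.along V W x + (-(1 / 2) : ℝ) • τ x (W x) (V x)) ∧
      g.IsBismut D ∧ ∀ x u v w, g.torsionForm D x u v w = g.leeTorsion x (θ x) u v w :=
    ⟨_, fun _ _ _ ↦ rfl, hD₀.isBismut_addOneForm hω hτ⟩
  -- The correction τ takes values in the kernel of θ, so θ is also parallel for the Bismut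
  -- connection.
  have hα (A B) (hA : IsSmoothVectorField A) (hB : IsSmoothVectorField B) (x : X) :
      nablaForm D θ A B x = 0 := by
    rw [nablaForm, hDD₀, map_add, map_smul, g.leeTorsion_inner_eq_zero x hE (hτ x), smul_zero,
      add_zero]
    exact hpar A B hA hB x
  have hs (A B) (hA : IsSmoothVectorField A) (hB : IsSmoothVectorField B) :=
    IsMetricConnection.isSmoothVectorField_along_of_leeTorsion hD.metric hE hθ hT hA hB
  have hN (A B C F) (hA : IsSmoothVectorField A) (hB : IsSmoothVectorField B)
      (hC : IsSmoothVectorField C) (hF : IsSmoothVectorField F) (x : X) :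
      g.nablaTorsion D A B C F x = 0 := by
    rw [nablaTorsion_eq_of_leeTorsion hD.metric hD.complex
      (fun _ h ↦ IsSmoothOneForm.apply hθ h) hT hA hB hC hF, hα _ _ hA hB.J, hα _ _ hA hC.J,
      hα _ _ hA hF.J]
    ring
  refine ⟨⟨D, hD, fun A B C F hA hB hC hF x ↦ ?_⟩, D, hD, fun A B C hA hB hC ↦ ?_⟩
  · rw [d₃_torsionForm hD.skew hA hB hC hF, hN _ _ _ _ hA hB hC hF, hN _ _ _ _ hB hA hC hF,
      hN _ _ _ _ hC hA hB hF, hN _ _ _ _ hF hA hB hC,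
      g.sum_inner_torsion_eq_zero x hE (hT x)]
    ring
  · funext x
    refine g.eq_of_inner_eq x fun z ↦ ?_
    obtain ⟨F, hF, rfl⟩ := exists_isSmoothVectorField x z
    rw [inner_cyclicSum_curvature hD.metric hD.skew hs hA hB hC hF, hN _ _ _ _ hA hB hC hF,
      hN _ _ _ _ hB hC hA hF, hN _ _ _ _ hC hA hB hF, g.sum_inner_torsion_eq_zero x hE (hT x)]
    simp

end VaismanToBismut

end HermitianMetric
end HermitianGeometry
end

theorem theoremA
    {E : Type*} [NormedAddCommGroup E] [NormedSpace ℂ E] [FiniteDimensional ℂ E]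
    (hE : Module.finrank ℂ E = 2)
    {X : Type*} [TopologicalSpace X] [T2Space X] [SecondCountableTopology X]
    [ChartedSpace E X] [IsManifold 𝓘(ℂ, E) ω X]
    (g : HermitianGeometry.HermitianMetric E X) :
    g.IsVaisman ↔ g.IsSKT ∧ g.BismutFirstBianchi :=
  ⟨fun h ↦ h.isSKT_and_firstBianchi hE, fun h ↦
    HermitianGeometry.HermitianMetric.isVaisman_of_isSKT_of_firstBianchi hE h.1 h.2⟩
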